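/- Let $k$ be a field of characteristic $0$ and $\mathbf T$ a neutral tannakian category over $k$, with duality $X\mapsto X^\vee$, transposition ${}^t$, and every object identified with its bidual. Write $\mathrm{Ext}=\mathrm{Ext}^1$. Let $A,B,N$ be objects of $\mathbf T$ and let $$0\to A\xrightarrow{j} M_1\xrightarrow{\pi} N\to 0,\qquad 0\to N\xrightarrow{\iota} M_2\xrightarrow{\varpi} B\to 0$$ be exact sequences. A *blended extension* (extension panachée) of $M_2$ by $M_1$ is an object $M$ with morphisms $\tilde\iota:M_1\to M$ and $\tilde\pi:M\to M_2$ such that $\tilde\pi\tilde\iota=\iota\pi$ and such that, with $\tilde j=\tilde\iota j$ and $\tilde\varpi=\varpi\tilde\pi$, the sequences $0\to A\xrightarrow{\tilde j}M\xrightarrow{\tilde\pi}M_2\to0$ and $0\to M_1\xrightarrow{\tilde\iota}M\xrightarrow{\tilde\varpi}B\to0$ are exact; an isomorphism of blended extensions is an isomorphism of the objects $M$ inducing the identity on $M_1$ and on $M_2$. Let $\mathrm{Extpan}(M_2,M_1)$ be the set of isomorphism classes, and assume that it is non-empty. For a blended extension $M$ and an extension $U$ of $B$ by $A$, let $M*U$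 be the quotient of $M\times_B U$ by the antidiagonal copy $\{(\tilde j(a),-a)\}$ of $A$, with the blended extension structure induced by that of $M$; as an extension of $B$ by $M_1$ it is the Baer sum of $M$ and $j_*U$. Assume that $\mathrm{Hom}(N,A)=0$, let $\varepsilon\in\{1,-1\}$, let $\phi:N\to N^\vee$ and $\lambda:A\to B^\vee$ be isomorphisms with ${}^t\phi=\varepsilon\phi$, and let $\Phi:M_1\to M_2^\vee$ be a morphism with $\Phi\circ j={}^t\varpi\circ\lambda$ and ${}^t\iota\circ\Phi=\phi\circ\pi$. A blended extension $M$ is *self-dual relative to $\Phi$* if there is a morphism $\psi:M\to M^\vee$ with $\psi\circ\tilde\iota={}^t\tilde\pi\circ\Phi$ and ${}^t\tilde j\circ\psi=\varepsilon\,{}^t\lambda\circ\tilde\varpi$. Let $\mathrm{Extpanaut}(M_2,M_1,\Phi)\subseteq\mathrm{Extpan}(M_2,M_1)$ be the set of classes of such $M$. Let $\mathrm{Ext}_{\pm}(B,B^\vee)$ be the set of classes in $\mathrm{Ext}(B,B^\vee)$ of the extensions $C$ of $B$ by $B^\vee$ whose dual extension satisfies $C^\vee\simeq\pm C$. Then $\mathrm{Extpanaut}(M_2,M_1,\Phi)$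 is non-empty, $\mathrm{Ext}_\varepsilon(B,B^\vee)$ is a subgroup of $\mathrm{Ext}(B,B^\vee)$, and $\mathrm{Extpanaut}(M_2,M_1,\Phi)$ is a torsor under $\mathrm{Ext}_\varepsilon(B,B^\vee)$ for the action in which $\lambda_*[U]\in \mathrm{Ext}_\varepsilon(B,B^\vee)$, for an extension $U$ of $B$ by $A$, sends $[M]$ to $[M*U]$. In particular, if $\mathrm{Ext}(B,B^\vee)=\mathrm{Ext}_\varepsilon(B,B^\vee)$ then $\mathrm{Extpanaut}(M_2,M_1,\Phi)=\mathrm{Extpan}(M_2,M_1)$, and if $\mathrm{Ext}(B,B^\vee)=\mathrm{Ext}_{-\varepsilon}(B,B^\vee)$ then $\mathrm{Extpanaut}(M_2,M_1,\Phi)$ has exactly one element. -/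

import Mathlib

open CategoryTheory MonoidalCategory Limits Abelian

universe w' w v u

attribute [-instance] CategoryTheory.catToReflQuiver

namespace SelfDualBlended

/-! ### Extensions and blended extensions in an abelian category -/

section Extensions

variable {C : Type u} [Category.{v} C] [Abelian C]

/-- A `1`-extension of `Q` by `P`: a short exact sequence `0 ⟶ P ⟶ E ⟶ Q ⟶ 0`. -/
structure Extn (Q P : C) where
  /-- the middle object `E` -/
  obj : C
  /-- the inclusion `P ⟶ E` -/
  i : P ⟶ obj
  /-- the projection `E ⟶ Q` -/
  p : obj ⟶ Q
  zero : i ≫ p = 0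
  exact : (ShortComplex.mk i p zero).ShortExact

/-- The class of an extension of `Q` by `P` in the group `Ext¹(Q, P)`. -/
noncomputable def Extn.cls [HasExt.{w} C] {Q P : C} (U : Extn Q P) : Ext.{w} Q P 1 :=
  U.exact.extClass

/-- A blended extension (extension panachée) of the extension `M₂` of `B` by `N` by the
extension `M₁` of `N` by `A`: an object with morphisms `ι : M₁ ⟶ M` and `π : M ⟶ M₂` such that
the square on `M₁ ⟶ N ⟶ M₂` commutes, the row `0 ⟶ A ⟶ M ⟶ M₂ ⟶ 0` is exact and the
column `0 ⟶ M₁ ⟶ M ⟶ B ⟶ 0` is exact. -/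
structure Blended {A N B : C} (M₂ : Extn B N) (M₁ : Extn N A) where
  obj : C
  ι : M₁.obj ⟶ obj
  π : obj ⟶ M₂.obj
  comm : ι ≫ π = M₁.p ≫ M₂.i
  row_zero : (M₁.i ≫ ι) ≫ π = 0
  row : (ShortComplex.mk (M₁.i ≫ ι) π row_zero).ShortExact
  col_zero : ι ≫ π ≫ M₂.p = 0
  col : (ShortComplex.mk ι (π ≫ M₂.p) col_zero).ShortExact

namespace Blended

variable {A N B : C} {M₂ : Extn B N} {M₁ : Extn N A}

/-- The inclusion `A ⟶ M`. -/
def incl (M : Blended M₂ M₁) : A ⟶ M.obj := M₁.i ≫ M.ι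

/-- The projection `M ⟶ B`. -/
def proj (M : Blended M₂ M₁) : M.obj ⟶ B := M.π ≫ M₂.p

/-- Isomorphism of blended extensions: an isomorphism inducing the identity on `M₁` and `M₂`. -/
def IsIsomorphic (M M' : Blended M₂ M₁) : Prop :=
  ∃ e : M.obj ≅ M'.obj, M.ι ≫ e.hom = M'.ι ∧ e.hom ≫ M'.π = M.π

/-- The isomorphism relation on blended extensions of `M₂` by `M₁`. -/
def setoid (M₂ : Extn B N) (M₁ : Extn N A) : Setoid (Blended M₂ M₁) where
  r := IsIsomorphic
  iseqv :=
    { refl := fun M => ⟨Iso.refl _, by simp, by simp⟩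
      symm := by
        rintro M M' ⟨e, h1, h2⟩
        exact ⟨e.symm, by simp [← h1], by simp [← h2]⟩
      trans := by
        rintro M M' M'' ⟨e, h1, h2⟩ ⟨e', h1', h2'⟩
        exact ⟨e ≪≫ e', by simp [← h1, ← h1'], by simp [← h2, ← h2']⟩ }

end Blended

/-- `Extpan(M₂, M₁)`: the set of isomorphism classes of blended extensions of `M₂` by `M₁`. -/
def Extpan {A N B : C} (M₂ : Extn B N) (M₁ : Extn N A) : Type (max u v) :=
  Quotient (Blended.setoid M₂ M₁)

/-- The isomorphism class of a blended extension. -/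
def Blended.cls {A N B : C} {M₂ : Extn B N} {M₁ : Extn N A} (M : Blended M₂ M₁) :
    Extpan M₂ M₁ :=
  Quotient.mk (Blended.setoid M₂ M₁) M

/-! ### The translate `M * U` of a blended extension by an extension of `B` by `A` -/

namespace Blended

variable {A N B : C} {M₂ : Extn B N} {M₁ : Extn N A}

noncomputable section

variable (M : Blended M₂ M₁) (U : Extn B A)

lemma incl_proj : M.incl ≫ M.proj = 0 := by
  simp [incl, proj, M.col_zero]

lemma ι_proj : M.ι ≫ M.proj = 0 := M.col_zero

/-- The antidiagonal `a ↦ (a, -a)` from `A` to the fibre product `M ×_B U`. -/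
def antidiag : A ⟶ pullback M.proj U.p :=
  pullback.lift M.incl (-U.i) (by rw [incl_proj, Preadditive.neg_comp, U.zero, neg_zero])

/-- The morphism `m₁ ↦ (m₁, 0)` from `M₁` to the fibre product `M ×_B U`. -/
def inlFib : M₁.obj ⟶ pullback M.proj U.p :=
  pullback.lift M.ι 0 (by rw [ι_proj, zero_comp])

lemma antidiag_fst : M.antidiag U ≫ pullback.fst _ _ = M.incl :=
  pullback.lift_fst _ _ _
lemma antidiag_snd : M.antidiag U ≫ pullback.snd _ _ = -U.i :=
  pullback.lift_snd _ _ _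
lemma inlFib_fst : M.inlFib U ≫ pullback.fst _ _ = M.ι :=
  pullback.lift_fst _ _ _
lemma inlFib_snd : M.inlFib U ≫ pullback.snd _ _ = 0 :=
  pullback.lift_snd _ _ _

/-- The morphism `M₁ ⟶ M * U = (M ×_B U) / A`, `m₁ ↦ [(m₁, 0)]`. -/
def trι : M₁.obj ⟶ cokernel (M.antidiag U) :=
  M.inlFib U ≫ cokernel.π (M.antidiag U)

/-- The morphism `M * U = (M ×_B U) / A ⟶ M₂`, `[(m, u)] ↦ π(m)`. -/
def trπ : cokernel (M.antidiag U) ⟶ M₂.obj :=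
  cokernel.desc (M.antidiag U) (pullback.fst M.proj U.p ≫ M.π) (by
    rw [← Category.assoc, antidiag_fst]; exact M.row_zero)

lemma coker_trπ :
    cokernel.π (M.antidiag U) ≫ M.trπ U = pullback.fst M.proj U.p ≫ M.π := by
  simp [trπ]

lemma tr_comm : M.trι U ≫ M.trπ U = M₁.p ≫ M₂.i := by
  rw [trι, Category.assoc, coker_trπ, ← Category.assoc, inlFib_fst, M.comm]

lemma tr_row_zero : (M₁.i ≫ M.trι U) ≫ M.trπ U = 0 := by
  rw [Category.assoc, M.tr_comm U, ← Category.assoc, M₁.zero, zero_comp]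

lemma tr_col_zero : M.trι U ≫ M.trπ U ≫ M₂.p = 0 := by
  rw [← Category.assoc, M.tr_comm U, Category.assoc, M₂.zero, comp_zero]

lemma exact_antidiag :
    (ShortComplex.mk (M.antidiag U) (cokernel.π (M.antidiag U)) (by simp)).Exact :=
  ShortComplex.exact_cokernel _

lemma tr_mono : Mono (M.trι U) := by
  have hM : Mono M.ι := M.col.mono_f
  have hU : Mono U.i := U.exact.mono_f
  rw [Preadditive.mono_iff_cancel_zero]
  intro X x hx
  obtain ⟨Y, e, _, a, ha⟩ := (ShortComplex.exact_iff_exact_up_to_refinements _).1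
    (M.exact_antidiag U) (x ≫ M.inlFib U) (by rw [Category.assoc]; exact hx)
  change e ≫ x ≫ M.inlFib U = a ≫ M.antidiag U at ha
  have h1 := ha =≫ pullback.fst _ _
  have h2 := ha =≫ pullback.snd _ _
  simp only [Category.assoc, antidiag_fst, antidiag_snd, inlFib_fst, inlFib_snd, comp_zero,
    Preadditive.comp_neg] at h1 h2
  have ha0 : a = 0 := by
    rw [← cancel_mono U.i, zero_comp]
    exact neg_eq_zero.1 h2.symm
  rw [ha0, zero_comp, ← Category.assoc] at h1
  have h3 : e ≫ x = 0 := by rw [← cancel_mono M.ι, h1, zero_comp]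
  rw [← cancel_epi e, h3, comp_zero]

lemma tr_epi : Epi (M.trπ U) := by
  have : Epi U.p := U.exact.epi_g
  have : Epi M.π := M.row.epi_g
  have h : Epi (cokernel.π (M.antidiag U) ≫ M.trπ U) := by
    rw [coker_trπ]; infer_instance
  exact epi_of_epi (cokernel.π (M.antidiag U)) _

/-- If `y = (m, u)` has `m` in the image of `M₁` up to refinement, then its class in `M * U`
comes from `M₁`, the difference being given by elements of `A`. -/
lemma tr_lift {X Y : C} (t : X ⟶ cokernel (M.antidiag U)) (e : Y ⟶ X) [Epi e]
    (y : Y ⟶ pullback M.proj U.p) (hy : e ≫ t = y ≫ cokernel.π (M.antidiag U))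
    (m : Y ⟶ M₁.obj) (hm : y ≫ pullback.fst _ _ = m ≫ M.ι) :
    ∃ (Z : C) (e' : Z ⟶ Y) (_ : Epi e') (a : Z ⟶ A),
      (e' ≫ e) ≫ t = (e' ≫ m + a ≫ M₁.i) ≫ M.trι U := by
  have h2 : (y ≫ pullback.snd M.proj U.p) ≫ U.p = 0 := by
    rw [Category.assoc, ← pullback.condition, ← Category.assoc, hm, Category.assoc, ι_proj,
      comp_zero]
  obtain ⟨Z, e', he', a, ha⟩ := (ShortComplex.exact_iff_exact_up_to_refinements _).1
    U.exact.exact (y ≫ pullback.snd _ _) h2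
  change e' ≫ y ≫ pullback.snd _ _ = a ≫ U.i at ha
  refine ⟨Z, e', he', a, ?_⟩
  have key : e' ≫ y = (e' ≫ m + a ≫ M₁.i) ≫ M.inlFib U - a ≫ M.antidiag U := by
    apply pullback.hom_ext
    · simp [Preadditive.sub_comp, antidiag_fst, inlFib_fst, hm, incl]
    · simp [Preadditive.sub_comp, antidiag_snd, inlFib_snd, ha]
  rw [Category.assoc, hy, ← Category.assoc, key, trι, Preadditive.sub_comp, Category.assoc,
    Category.assoc a, cokernel.condition, comp_zero, sub_zero]

lemma tr_col_exact : (ShortComplex.mk _ _ (M.tr_col_zero U)).Exact := by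
  rw [ShortComplex.exact_iff_exact_up_to_refinements]
  intro X t ht
  change t ≫ M.trπ U ≫ M₂.p = 0 at ht
  obtain ⟨Y, e, _, y, hy⟩ := surjective_up_to_refinements_of_epi (cokernel.π (M.antidiag U)) t
  have h1 : (y ≫ pullback.fst _ _) ≫ M.proj = 0 := by
    have h := hy =≫ (M.trπ U ≫ M₂.p)
    rw [Category.assoc, ht, comp_zero, Category.assoc, ← Category.assoc (cokernel.π _),
      coker_trπ] at h
    rw [Category.assoc] at h
    change _ ≫ M.π ≫ M₂.p = 0
    rw [Category.assoc]
    exact h.symm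
  obtain ⟨Y', e', _, m, hm⟩ := (ShortComplex.exact_iff_exact_up_to_refinements _).1
    M.col.exact _ h1
  obtain ⟨Z, e'', _, a, ha⟩ := M.tr_lift U t (e' ≫ e) (e' ≫ y)
    (by rw [Category.assoc, hy, Category.assoc]) m (by rw [Category.assoc]; exact hm)
  exact ⟨Z, e'' ≫ e' ≫ e, inferInstance, _, ha⟩

lemma tr_row_exact : (ShortComplex.mk _ _ (M.tr_row_zero U)).Exact := by
  rw [ShortComplex.exact_iff_exact_up_to_refinements]
  intro X t ht
  change t ≫ M.trπ U = 0 at ht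
  obtain ⟨Y, e, _, y, hy⟩ := surjective_up_to_refinements_of_epi (cokernel.π (M.antidiag U)) t
  have h1 : (y ≫ pullback.fst _ _) ≫ M.π = 0 := by
    have h := hy =≫ M.trπ U
    rw [Category.assoc, ht, comp_zero, Category.assoc, coker_trπ] at h
    simpa using h.symm
  obtain ⟨Y', e', _, b, hb⟩ := (ShortComplex.exact_iff_exact_up_to_refinements _).1
    M.row.exact _ h1
  change e' ≫ y ≫ pullback.fst _ _ = b ≫ M₁.i ≫ M.ι at hb
  obtain ⟨Z, e'', _, a, ha⟩ := M.tr_lift U t (e' ≫ e) (e' ≫ y)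
    (by rw [Category.assoc, hy, Category.assoc]) (b ≫ M₁.i)
    (by rw [Category.assoc, hb, Category.assoc])
  refine ⟨Z, e'' ≫ e' ≫ e, inferInstance, e'' ≫ b + a, ?_⟩
  change _ = (e'' ≫ b + a) ≫ M₁.i ≫ M.trι U
  rw [ha, ← Category.assoc (e'' ≫ b + a)]
  congr 1
  rw [Preadditive.add_comp, Category.assoc]

/-- The translate `M * U` of the blended extension `M` of `M₂` by `M₁` by the extension `U` of
`B` by `A`: it is `{(m, u) | m and u have the same image in B} / {(a, -a) | a in A}`, which as
an extension of `B` by `M₁` is the Baer sum of `M` and of the pushout of `U` along `A ⟶ M₁`. -/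
def translate : Blended M₂ M₁ where
  obj := cokernel (M.antidiag U)
  ι := M.trι U
  π := M.trπ U
  comm := M.tr_comm U
  row_zero := M.tr_row_zero U
  row :=
    { exact := M.tr_row_exact U
      mono_f := by
        have h1 := M.tr_mono U
        have h2 : Mono M₁.i := M₁.exact.mono_f
        exact mono_comp _ _
      epi_g := M.tr_epi U }
  col_zero := M.tr_col_zero U
  col :=
    { exact := M.tr_col_exact U
      mono_f := M.tr_mono U
      epi_g := by
        have h1 := M.tr_epi U
        have h2 : Epi M₂.p := M₂.exact.epi_g
        exact epi_comp _ _ }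

end

end Blended

end Extensions

/-! ### Duality and transposition in a rigid braided category -/

section Duality

variable {C : Type u} [Category.{v} C] [MonoidalCategory C] [RightRigidCategory C]

/-- The dual of an object. -/
abbrev dual (X : C) : C := HasRightDual.rightDual X

/-- The transpose `dual Y ⟶ dual X` of a morphism `X ⟶ Y`. -/
abbrev tr {X Y : C} (f : X ⟶ Y) : dual Y ⟶ dual X := rightAdjointMate f

lemma tensorRightHomEquiv_surj {Z X : C} (l : Z ⊗ X ⟶ 𝟙_ C) :
    ∃ l' : Z ⟶ dual X, l' ▷ X ≫ ε_ X (dual X) = l := by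
  refine ⟨tensorRightHomEquiv Z X (dual X) (𝟙_ C) l ≫ (λ_ _).hom, ?_⟩
  apply (tensorRightHomEquiv Z X (dual X) (𝟙_ C)).injective
  rw [tensorRightHomEquiv_whiskerRight_comp_evaluation, Category.assoc, Iso.hom_inv_id,
    Category.comp_id]

section Bidual

variable [BraidedCategory C]

/-- The canonical isomorphism of an object with its bidual: through the braiding, `X` is a dual
of `dual X`, and duals are unique up to a unique isomorphism. -/
noncomputable def bidual (X : C) : X ≅ dual (dual X) :=
  rightDualIso (BraidedCategory.exactPairing_swap X (dual X)) HasRightDual.exact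

/-- The transpose `Y ⟶ dual X` of a morphism `X ⟶ dual Y`, the bidual of `Y` being identified
with `Y`. -/
noncomputable def transpose {X Y : C} (f : X ⟶ dual Y) : Y ⟶ dual X := (bidual Y).hom ≫ tr f

lemma mate_swap {X Y : C} (f : X ⟶ Y) :
    @rightAdjointMate C _ _ (dual Y) (dual X)
      (@HasRightDual.mk _ _ _ _ Y (BraidedCategory.exactPairing_swap Y (dual Y)))
      (@HasRightDual.mk _ _ _ _ X (BraidedCategory.exactPairing_swap X (dual X))) (tr f) = f := by
  let pX := BraidedCategory.exactPairing_swap X (dual X)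
  let pY := BraidedCategory.exactPairing_swap Y (dual Y)
  let dX : HasRightDual (dual X) := ⟨X⟩
  let dY : HasRightDual (dual Y) := ⟨Y⟩
  apply (cancel_mono (λ_ Y).inv).1
  have h1 := @tensorRightHomEquiv_whiskerLeft_comp_evaluation C _ _ (dual Y) (dual X) dY dX (tr f)
  have h2 := @tensorRightHomEquiv_whiskerRight_comp_evaluation C _ _ (dual Y) X dY f
  refine h1.symm.trans (Eq.trans ?_ h2)
  congr 1
  change X ◁ tr f ≫ (β_ X (dual X)).hom ≫ ε_ X (dual X) =
    f ▷ dual Y ≫ (β_ Y (dual Y)).hom ≫ ε_ Y (dual Y)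
  rw [BraidedCategory.braiding_naturality_right_assoc,
    BraidedCategory.braiding_naturality_left_assoc, rightAdjointMate_comp_evaluation]

lemma bidual_naturality {X Y : C} (f : X ⟶ Y) :
    f ≫ (bidual Y).hom = (bidual X).hom ≫ tr (tr f) := by
  have h1 := @comp_rightAdjointMate C _ _ (dual Y) (dual Y) (dual X) _
    (@HasRightDual.mk _ _ _ _ Y (BraidedCategory.exactPairing_swap Y (dual Y)))
    (@HasRightDual.mk _ _ _ _ X (BraidedCategory.exactPairing_swap X (dual X))) (𝟙 _) (tr f)
  have h2 := @comp_rightAdjointMate C _ _ (dual Y) (dual X) (dual X) _ _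
    (@HasRightDual.mk _ _ _ _ X (BraidedCategory.exactPairing_swap X (dual X))) (tr f) (𝟙 _)
  rw [mate_swap, Category.id_comp] at h1
  rw [Category.comp_id] at h2
  exact h1.symm.trans h2

lemma tr_injective {X Y : C} {f g : X ⟶ Y} (h : tr f = tr g) : f = g := by
  rw [← cancel_mono (bidual Y).hom, bidual_naturality, bidual_naturality, h]

end Bidual

variable [Abelian C] [MonoidalPreadditive C]

lemma tr_zero (X Y : C) : tr (0 : X ⟶ Y) = 0 := by
  simp [tr, rightAdjointMate]

lemma dual_zero {X Y Z : C} {f : X ⟶ Y} {g : Y ⟶ Z} (h : f ≫ g = 0) : tr g ≫ tr f = 0 := by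
  rw [← comp_rightAdjointMate, h, ← tr_zero]

variable [BraidedCategory C]

lemma dual_mono {X Y : C} (g : X ⟶ Y) [Epi g] : Mono (tr g) := by
  rw [Preadditive.mono_iff_cancel_zero]
  intro Z f hf
  let := BraidedCategory.exactPairing_swap Z (dual Z)
  have := (tensorLeftAdjunction (dual Z) Z).leftAdjoint_preservesColimits
  have : Epi ((tensorLeft Z).map g) := inferInstance
  have : Epi (Z ◁ g) := this
  have h : Z ◁ g ≫ f ▷ Y ≫ ε_ Y (dual Y) = 0 := by
    rw [whisker_exchange_assoc, ← rightAdjointMate_comp_evaluation, ← comp_whiskerRight_assoc, hf]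
    simp
  have h' : f ▷ Y ≫ ε_ Y (dual Y) = 0 ▷ Y ≫ ε_ Y (dual Y) := by
    rw [← cancel_epi (Z ◁ g), h]; simp
  apply (cancel_mono (λ_ (dual Y)).inv).1
  rw [← tensorRightHomEquiv_whiskerRight_comp_evaluation,
    ← tensorRightHomEquiv_whiskerRight_comp_evaluation, h']

lemma dual_epi {X Y : C} (g : X ⟶ Y) [Mono g] : Epi (tr g) := by
  rw [Preadditive.epi_iff_cancel_zero]
  intro Z f hf
  have h1 : tr f ≫ tr (tr g) = 0 := by rw [← comp_rightAdjointMate, hf, ← tr_zero]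
  have h2 : (tr f ≫ (bidual X).inv) ≫ g = 0 := by
    rw [← cancel_mono (bidual Y).hom, Category.assoc, Category.assoc, bidual_naturality,
      Iso.inv_hom_id_assoc, h1, zero_comp]
  have h3 : tr f ≫ (bidual X).inv = 0 := by rw [← cancel_mono g, h2, zero_comp]
  apply tr_injective
  rw [tr_zero, ← cancel_mono (bidual X).inv, h3, zero_comp]

lemma dual_lift {S : ShortComplex C} (hS : S.ShortExact) {Z : C} (f : Z ⟶ dual S.X₂)
    (hf : f ≫ tr S.f = 0) : ∃ l : Z ⟶ dual S.X₃, l ≫ tr S.g = f := by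
  let := BraidedCategory.exactPairing_swap Z (dual Z)
  have := hS.epi_g
  have := (tensorLeftAdjunction (dual Z) Z).leftAdjoint_preservesColimits
  have hS' := hS.exact.map_of_epi_of_preservesCokernel (tensorLeft Z) inferInstance inferInstance
  have : Epi (S.map (tensorLeft Z)).g := by change Epi ((tensorLeft Z).map S.g); infer_instance
  have hg : Z ◁ S.f ≫ f ▷ S.X₂ ≫ ε_ S.X₂ (dual S.X₂) = 0 := by
    rw [whisker_exchange_assoc, ← rightAdjointMate_comp_evaluation, ← comp_whiskerRight_assoc, hf]
    simp
  obtain ⟨l, hl⟩ : ∃ l : Z ⊗ S.X₃ ⟶ 𝟙_ C, Z ◁ S.g ≫ l = f ▷ S.X₂ ≫ ε_ S.X₂ (dual S.X₂) :=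
    hS'.desc' _ hg
  obtain ⟨l', rfl⟩ := tensorRightHomEquiv_surj l
  refine ⟨l', ?_⟩
  apply (cancel_mono (λ_ _).inv).1
  rw [← tensorRightHomEquiv_whiskerRight_comp_evaluation,
    ← tensorRightHomEquiv_whiskerRight_comp_evaluation, ← hl, comp_whiskerRight, Category.assoc,
    rightAdjointMate_comp_evaluation, whisker_exchange_assoc]

/-- Duality turns a short exact sequence into a short exact sequence. -/
lemma dual_shortExact {X Y Z : C} {f : X ⟶ Y} {g : Y ⟶ Z} {h : f ≫ g = 0}
    (hS : (ShortComplex.mk f g h).ShortExact) :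
    (ShortComplex.mk (tr g) (tr f) (dual_zero h)).ShortExact := by
  have : Mono f := hS.mono_f
  have : Epi g := hS.epi_g
  refine { exact := ?_, mono_f := dual_mono g, epi_g := dual_epi f }
  rw [ShortComplex.exact_iff_exact_up_to_refinements]
  intro Z t ht
  obtain ⟨l, hl⟩ := dual_lift hS t ht
  exact ⟨Z, 𝟙 _, inferInstance, l, by rw [Category.id_comp]; exact hl.symm⟩

/-- The dual of an extension of `Q` by `P`, an extension of `dual P` by `dual Q`. -/
def Extn.dual {Q P : C} (U : Extn Q P) : Extn (dual P) (dual Q) where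
  obj := SelfDualBlended.dual U.obj
  i := tr U.p
  p := tr U.i
  zero := dual_zero U.zero
  exact := dual_shortExact U.exact

/-- The dual of an extension `0 ⟶ dual B ⟶ E ⟶ B ⟶ 0`, seen again as an extension of `B` by
`dual B` through the canonical isomorphism of `B` with its bidual. -/
noncomputable def Extn.dualSelf {B : C} (U : Extn B (SelfDualBlended.dual B)) :
    Extn B (SelfDualBlended.dual B) where
  obj := U.dual.obj
  i := U.dual.i
  p := U.dual.p ≫ (bidual B).inv
  zero := by rw [← Category.assoc, U.dual.zero, zero_comp]
  exact := ShortComplex.shortExact_of_iso (S₁ := ShortComplex.mk _ _ U.dual.zero)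
    (ShortComplex.isoMk (Iso.refl _) (Iso.refl _) (bidual B).symm (by simp) (by simp))
    U.dual.exact

/-- `Ext_ε(B, dual B)`: the classes of the extensions `U` of `B` by `dual B` whose dual is
isomorphic to `ε U`, as an equality of classes in `Ext¹(B, dual B)`. -/
def extSign [HasExt.{w} C] (ε : ℤˣ) (B : C) : Set (Ext.{w} B (dual B) 1) :=
  {x | ∃ U : Extn B (dual B), U.cls = x ∧ U.dualSelf.cls = (ε : ℤ) • x}

variable {A N B : C} {M₂ : Extn B N} {M₁ : Extn N A}

/-- The dual of a blended extension of `M₂` by `M₁`, a blended extension of the dual of `M₁` by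
the dual of `M₂`. -/
def Blended.dual (M : Blended M₂ M₁) : Blended M₁.dual M₂.dual where
  obj := SelfDualBlended.dual M.obj
  ι := tr M.π
  π := tr M.ι
  comm := by
    change tr M.π ≫ tr M.ι = tr M₂.i ≫ tr M₁.p
    rw [← comp_rightAdjointMate, M.comm, comp_rightAdjointMate]
  row_zero := by
    change (tr M₂.p ≫ tr M.π) ≫ tr M.ι = 0
    rw [← comp_rightAdjointMate]
    exact dual_zero M.col_zero
  row := by
    have h := dual_shortExact M.col
    simp only [tr, comp_rightAdjointMate] at h
    exact h
  col_zero := by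
    change tr M.π ≫ tr M.ι ≫ tr M₁.i = 0
    rw [← comp_rightAdjointMate]
    exact dual_zero M.row_zero
  col := by
    have h := dual_shortExact M.row
    simp only [tr, comp_rightAdjointMate] at h
    exact h

/-- `M` is self-dual relative to `Φ : M₁ ⟶ dual M₂` (and to the sign `ε` and to
`lam : A ⟶ dual B`): `Φ` extends to a morphism `ψ : M ⟶ dual M` which induces `ε ᵗlam` from
`B` to `dual A` on the quotients. -/
def Blended.IsSelfDual (ε : ℤˣ) (lam : A ⟶ SelfDualBlended.dual B)
    (Φ : M₁.obj ⟶ M₂.dual.obj) (M : Blended M₂ M₁) : Prop :=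
  ∃ ψ : M.obj ⟶ M.dual.obj,
    M.ι ≫ ψ = Φ ≫ M.dual.ι ∧ ψ ≫ M.dual.proj = M.proj ≫ ((ε : ℤ) • transpose lam)

/-- `Extpanaut(M₂, M₁, Φ)`: the classes of the blended extensions of `M₂` by `M₁` that are
self-dual relative to `Φ`. -/
def extpanaut (ε : ℤˣ) (lam : A ⟶ SelfDualBlended.dual B) (Φ : M₁.obj ⟶ M₂.dual.obj) :
    Set (Extpan M₂ M₁) :=
  {x | ∃ M : Blended M₂ M₁, M.cls = x ∧ M.IsSelfDual ε lam Φ}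

end Duality

/-- A rigid symmetric `k`-linear abelian tensor category is neutral tannakian over the field `k`
if the endomorphisms of its unit object are the scalars and if it has a fibre functor over `k`:
an exact faithful `k`-linear symmetric tensor functor to finite-dimensional vector spaces. -/
class NeutralTannakian (k : Type w') [Field k] (C : Type u) [Category.{v} C] [Abelian C]
    [Linear k C] [MonoidalCategory C] [MonoidalPreadditive C] [MonoidalLinear k C]
    [SymmetricCategory C] [RightRigidCategory C] : Prop where
  end_unit : Function.Bijective (algebraMap k (End (𝟙_ C)))
  exists_fibre_functor : ∃ ω : C ⥤ FGModuleCat.{w'} k, Nonempty ω.Braided ∧ ω.Additive ∧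
    ω.Linear k ∧ ω.Faithful ∧ PreservesFiniteLimits ω ∧ PreservesFiniteColimits ω

end SelfDualBlended

open SelfDualBlended

/-! Duality acts on blended extensions as an involution, and self-dual ones are its fixed points. By
the five lemma `Φ` is an isomorphism. With `Θ = ε ᵗΦ : M₂ ≅ M₁^∨` it turns `M^∨` back into a blended
extension of `M₂` by `M₁`, which gives a map `D` on `Extpan(M₂, M₁)`. It is an involution because
`ε` times biduality identifies `M` with its double dual. The definition of self-duality prescribes
`ψ` only on `M₁` and on the quotients `B → A^∨`. Since `Hom(B, N^∨) ≅ Hom(N, B^∨) ≅ Hom(N, A) = 0`,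
this already forces compatibility with `Θ`, so self-dual means `D[M] = [M]` (`isSelfDual_iff`).

To compute with `D`, send `M` to the class of its row in `Ext(M₂, A) ≅ Ext(M₂, B^∨)`. As `Hom(N, A)
= 0`, this is injective and so is `Ext(B, B^∨) → Ext(M₂, B^∨)`. The image is a coset of the image of
`Ext(B, B^∨)`, and `M ↦ M * U` is translation by `λ_*[U]`. Duality exchanges rows and columns, and
the column of `M * U` is that of `M` plus `j_*[U]`. Hence `D(x + u) = D(x) + τ(u)` with `τ(u) = ε
u^∨` (`rowClass_dualExtpan`).

The rest is formal. If `D(x) = x + u`, then `D² = 1` gives `τ(u) = -u`, and `x + u/2` is fixed;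
halving is possible because `k` has characteristic `0`. The fixed points form a torsor under `{u |
τ(u) = u} = Ext_ε(B, B^∨)`. If `Ext_{-ε}` is everything, this group has only `2`-torsion, hence is
zero. -/

namespace SelfDualBlended

/-! ### Functoriality of `Ext¹` and its description by extensions -/

section ExtOne

variable {C : Type u} [Category.{v} C] [Abelian C] [HasExt.{w} C]

/-- The pullback of classes of extensions along a morphism of quotients. -/
noncomputable def pull {Q' Q P : C} (a : Q' ⟶ Q) : Ext.{w} Q P 1 →+ Ext.{w} Q' P 1 :=
  (Ext.mk₀ a).precomp P (zero_add 1)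

/-- The pushout of classes of extensions along a morphism of subobjects. -/
noncomputable def push {Q P P' : C} (b : P ⟶ P') : Ext.{w} Q P 1 →+ Ext.{w} Q P' 1 :=
  (Ext.mk₀ b).postcomp Q (add_zero 1)

variable {Q Q' Q'' P P' P'' : C}

lemma pull_def (a : Q' ⟶ Q) (x : Ext.{w} Q P 1) : pull a x = (Ext.mk₀ a).comp x (zero_add 1) :=
  rfl

lemma push_def (b : P ⟶ P') (x : Ext.{w} Q P 1) : push b x = x.comp (Ext.mk₀ b) (add_zero 1) :=
  rfl

@[simp]
lemma pull_pull (a' : Q'' ⟶ Q') (a : Q' ⟶ Q) (x : Ext.{w} Q P 1) :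
    pull a' (pull a x) = pull (a' ≫ a) x := by
  simp [pull_def]

@[simp]
lemma push_push (b : P ⟶ P') (b' : P' ⟶ P'') (x : Ext.{w} Q P 1) :
    push b' (push b x) = push (b ≫ b') x := by
  simp [push_def]

lemma pull_push (a : Q' ⟶ Q) (b : P ⟶ P') (x : Ext.{w} Q P 1) :
    pull a (push b x) = push b (pull a x) := by
  simp [push_def, pull_def]

@[simp]
lemma pull_id (x : Ext.{w} Q P 1) : pull (𝟙 Q) x = x := by simp [pull_def]

@[simp]
lemma push_id (x : Ext.{w} Q P 1) : push (𝟙 P) x = x := by simp [push_def]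

lemma pull_add (a b : Q' ⟶ Q) (x : Ext.{w} Q P 1) : pull (a + b) x = pull a x + pull b x := by
  simp [pull_def, Ext.mk₀_add]

lemma push_add (a b : P ⟶ P') (x : Ext.{w} Q P 1) : push (a + b) x = push a x + push b x := by
  simp [push_def, Ext.mk₀_add]

@[simp]
lemma push_zero (x : Ext.{w} Q P 1) : push (0 : P ⟶ P') x = 0 := by simp [push_def]

lemma pull_neg (a : Q' ⟶ Q) (x : Ext.{w} Q P 1) : pull (-a) x = -pull a x := by
  simp [pull_def]

lemma pull_sub (a b : Q' ⟶ Q) (x : Ext.{w} Q P 1) : pull (a - b) x = pull a x - pull b x := by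
  rw [sub_eq_add_neg, pull_add, pull_neg, sub_eq_add_neg]

lemma pull_units_smul (ε : ℤˣ) (a : Q' ⟶ Q) (x : Ext.{w} Q P 1) :
    pull ((ε : ℤ) • a) x = (ε : ℤ) • pull a x := by
  rcases Int.units_eq_one_or ε with rfl | rfl <;> simp [pull_neg]

namespace Extn

/-- A morphism of extensions relates their classes. -/
lemma cls_naturality (E : Extn Q P) (E' : Extn Q' P') (b : P ⟶ P') (f : E.obj ⟶ E'.obj)
    (a : Q ⟶ Q') (hb : E.i ≫ f = b ≫ E'.i) (ha : f ≫ E'.p = E.p ≫ a) :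
    push b E.cls = pull a E'.cls :=
  ShortComplex.ShortExact.extClass_naturality E.exact E'.exact
    (ShortComplex.Hom.mk b f a hb.symm ha)

/-- A relation between the classes of two extensions comes from a morphism of extensions. -/
lemma exists_hom (E : Extn Q P) (E' : Extn Q' P') (b : P ⟶ P') (a : Q ⟶ Q')
    (h : push.{w} b E.cls = pull a E'.cls) :
    ∃ f : E.obj ⟶ E'.obj, E.i ≫ f = b ≫ E'.i ∧ f ≫ E'.p = E.p ≫ a := by
  have hE : Epi E.p := E.exact.epi_g
  have h0 : push.{w} E'.i E'.cls = 0 := E'.exact.extClass_comp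
  have h1 : push.{w} (b ≫ E'.i) E.cls = 0 := by
    rw [← push_push, h, ← pull_push, h0, map_zero]
  -- The obstruction to extending `b ≫ E'.i` from `P` to `E` vanishes, but the extension `f` may
  -- induce some `q ≠ a` on quotients.
  obtain ⟨f₀, hf₀⟩ := Ext.contravariant_sequence_exact₁ E.exact _ (Ext.mk₀ (b ≫ E'.i))
    (add_zero 1) h1
  obtain ⟨f, rfl⟩ := (Ext.mk₀_bijective _ _).2 f₀
  replace hf₀ : E.i ≫ f = b ≫ E'.i := (Ext.mk₀_bijective _ _).1 (by simpa using hf₀)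
  obtain ⟨q, hq⟩ : ∃ q : Q ⟶ Q', E.p ≫ q = f ≫ E'.p :=
    E.exact.exact.desc' (f ≫ E'.p)
      (by change E.i ≫ f ≫ E'.p = 0; rw [reassoc_of% hf₀, E'.zero, comp_zero])
  -- The error `a - q` pulls `E'` back to a split extension, so it lifts to `r : Q ⟶ E'.obj`, and `f
  -- + E.p ≫ r` is the corrected morphism.
  have h2 : pull.{w} (a - q) E'.cls = 0 := by
    rw [pull_sub, ← h, cls_naturality E E' b f q hf₀ hq.symm, sub_self]
  obtain ⟨r₀, hr₀⟩ := Ext.covariant_sequence_exact₃ Q E'.exact (Ext.mk₀ (a - q)) (zero_add 1) h2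
  obtain ⟨r, rfl⟩ := (Ext.mk₀_bijective _ _).2 r₀
  replace hr₀ : r ≫ E'.p = a - q := (Ext.mk₀_bijective _ _).1 (by simpa using hr₀)
  have hz : E.i ≫ E.p = 0 := E.zero
  refine ⟨f + E.p ≫ r, ?_, ?_⟩
  · rw [Preadditive.comp_add, reassoc_of% hz, zero_comp, add_zero, hf₀]
  · rw [Preadditive.add_comp, Category.assoc, hr₀, Preadditive.comp_sub, hq]
    abel

/-- Every class in `Ext¹(Q, P)` is the class of an extension of `Q` by `P`. -/
lemma exists_cls (x : Ext.{w} Q P 1) : ∃ E : Extn Q P, E.cls = x := by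
  let := HasDerivedCategory.standard C
  let S := DerivedCategory.singleFunctor C 0
  let t := DerivedCategory.TStructure.t (C := C)
  let h : S.obj Q ⟶ (S.obj P)⟦(1 : ℤ)⟧ := x.hom
  -- Complete `Q → P[1]` to a triangle `P → Y → Q → P[1]`; the outer terms lie in the heart, hence
  -- so does `Y`, which provides the middle object.
  obtain ⟨Y, f, g, hT⟩ := Pretriangulated.distinguished_cocone_triangle₂ h
  have hLE (X : C) : t.IsLE (S.obj X) 0 :=
    inferInstanceAs (((DerivedCategory.singleFunctor C 0).obj X).IsLE 0)
  have hGE (X : C) : t.IsGE (S.obj X) 0 :=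
    inferInstanceAs (((DerivedCategory.singleFunctor C 0).obj X).IsGE 0)
  have hY1 : t.IsLE Y 0 := t.isLE₂ _ hT 0 (hLE P) (hLE Q)
  have hY2 : t.IsGE Y 0 := t.isGE₂ _ hT 0 (hGE P) (hGE Q)
  obtain ⟨E, ⟨e⟩⟩ := Y.exists_iso_singleFunctor_obj_of_isGE_of_isLE 0
  have hT' : Pretriangulated.Triangle.mk (f ≫ e.hom) (e.inv ≫ g) h ∈
      Pretriangulated.distinguishedTriangles :=
    Pretriangulated.isomorphic_distinguished _ hT _
      (Pretriangulated.Triangle.isoMk _ (Pretriangulated.Triangle.mk f g h) (Iso.refl _) e.symm (Iso.refl _) ?_ ?_ ?_)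
  rotate_left
  · change (f ≫ e.hom) ≫ e.inv = 𝟙 (S.obj P) ≫ f
    rw [Category.assoc, e.hom_inv_id, Category.comp_id, Category.id_comp]
  · exact Category.comp_id _
  · change h ≫ (shiftFunctor _ (1 : ℤ)).map (𝟙 (S.obj P)) = 𝟙 (S.obj Q) ≫ h
    rw [CategoryTheory.Functor.map_id, Category.comp_id, Category.id_comp]
  obtain ⟨i, hi⟩ := (S.map_surjective (f ≫ e.hom) : ∃ i : P ⟶ E, S.map i = f ≫ e.hom)
  obtain ⟨p, hp⟩ := (S.map_surjective (e.inv ≫ g) : ∃ p : E ⟶ Q, S.map p = e.inv ≫ g)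
  rw [← hi, ← hp] at hT'
  have zero : i ≫ p = 0 := S.map_injective (by
    rw [S.map_comp, S.map_zero]
    exact Pretriangulated.comp_distTriang_mor_zero₁₂ _ hT')
  have hi' : Mono i := by
    rw [Preadditive.mono_iff_cancel_zero]
    intro X u hu
    -- A morphism killed by `i` factors through `Q[-1]`, to which `X` has no nonzero morphism.
    obtain ⟨r, hr⟩ := Pretriangulated.Triangle.coyoneda_exact₂ _
      (Pretriangulated.inv_rot_of_distTriang _ hT') (S.map u)
      (by change S.map u ≫ S.map i = 0; rw [← S.map_comp, hu, S.map_zero])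
    have hr0 : r = 0 := t.zero_of_isLE_of_isGE r 0 1 (by lia) (hLE X)
      (t.isGE_shift (S.obj Q) 0 (-1) 1 (by lia))
    apply S.map_injective
    rw [hr, hr0, zero_comp, S.map_zero]
    rfl
  have hp' : Epi p := by
    rw [Preadditive.epi_iff_cancel_zero]
    intro X u hu
    -- Dually, a morphism killed by `p` factors through `P[1]`, which has no nonzero morphism to
    -- `X`.
    obtain ⟨r, hr⟩ := Pretriangulated.Triangle.yoneda_exact₃ _ hT' (S.map u)
      (by change S.map p ≫ S.map u = 0; rw [← S.map_comp, hu, S.map_zero])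
    have hr0 : r = 0 := t.zero_of_isLE_of_isGE r (-1) 0 (by lia)
      (t.isLE_shift (S.obj P) 0 1 (-1) (by lia)) (hGE X)
    apply S.map_injective
    rw [hr, hr0, comp_zero, S.map_zero]
    rfl
  have hex : (ShortComplex.mk i p zero).ShortExact :=
    { exact := by
        rw [ShortComplex.exact_iff_exact_up_to_refinements]
        intro X u hu
        obtain ⟨r, hr⟩ := Pretriangulated.Triangle.coyoneda_exact₂ _ hT' (S.map u)
          (by change S.map u ≫ S.map p = 0; rw [← S.map_comp]; erw [hu]; rw [S.map_zero])
        obtain ⟨r, rfl⟩ := S.map_surjective r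
        exact ⟨X, 𝟙 X, inferInstance, r, S.map_injective (by
          rw [Category.id_comp, hr, S.map_comp]; rfl)⟩ }
  refine ⟨⟨E, i, p, zero, hex⟩, ?_⟩
  -- The identities of `P` and `E` extend to a morphism of triangles; as `p` is epi its third
  -- component is the identity, so the two connecting morphisms agree.
  obtain ⟨c, hc1, hc2⟩ := Pretriangulated.complete_distinguished_triangle_morphism _ _ hT'
    hex.singleTriangle_distinguished (𝟙 (S.obj P)) (𝟙 (S.obj E))
    ((Category.comp_id (S.map i)).trans (Category.id_comp (S.map i)).symm)
  obtain ⟨c, rfl⟩ := S.map_surjective c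
  have hc : c = 𝟙 Q := by
    rw [← cancel_epi p, Category.comp_id]
    apply S.map_injective
    rw [S.map_comp]
    exact hc1.trans (Category.id_comp _)
  subst hc
  change hex.extClass = x
  apply Ext.ext
  rw [hex.extClass_hom]
  change h ≫ (shiftFunctor _ (1 : ℤ)).map (𝟙 (S.obj P)) = S.map (𝟙 Q) ≫ hex.singleδ at hc2
  rw [CategoryTheory.Functor.map_id, CategoryTheory.Functor.map_id, Category.comp_id, Category.id_comp] at hc2
  exact hc2.symm

end Extn

end ExtOne

/-! ### Row and column classes of blended extensions -/

section BlendedClasses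

variable {C : Type u} [Category.{v} C] [Abelian C]

namespace Extn

variable {Q P B A : C}

/-- A morphism of extensions inducing the identities of `P` and `Q` is an isomorphism. -/
lemma isIso_hom (E E' : Extn Q P) (f : E.obj ⟶ E'.obj) (hi : E.i ≫ f = E'.i)
    (hp : f ≫ E'.p = E.p) : IsIso f := by
  let φ : ShortComplex.mk _ _ E.zero ⟶ ShortComplex.mk _ _ E'.zero :=
    ShortComplex.Hom.mk (𝟙 P) f (𝟙 Q) (by simp [hi]) (by simp [hp])
  have h₁ : IsIso φ.τ₁ := inferInstanceAs (IsIso (𝟙 P))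
  have h₃ : IsIso φ.τ₃ := inferInstanceAs (IsIso (𝟙 Q))
  exact ShortComplex.isIso₂_of_shortExact_of_isIso₁₃ φ E.exact E'.exact

/-- The fibre product of an extension `E` of `Q` by `P` and of an extension `U` of `B` by `A`
over a morphism `Q ⟶ B`, as an extension of `Q` by `P ⊞ A`. -/
noncomputable def fibreProduct (E : Extn Q P) (U : Extn B A) (q : Q ⟶ B) (f : E.obj ⟶ B)
    (hf : E.p ≫ q = f) : Extn Q (P ⊞ A) where
  obj := pullback f U.p
  i := biprod.desc (pullback.lift E.i 0 (by rw [← hf, reassoc_of% E.zero, zero_comp, zero_comp]))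
    (pullback.lift 0 U.i (by rw [U.zero, zero_comp]))
  p := pullback.fst f U.p ≫ E.p
  zero := by apply biprod.hom_ext' <;> simp [E.zero, pullback.lift_fst_assoc]
  exact := by
    have hE : Mono E.i := E.exact.mono_f
    have hE' : Epi E.p := E.exact.epi_g
    have hU : Mono U.i := U.exact.mono_f
    have hU' : Epi U.p := U.exact.epi_g
    have fstE (X : C) (t : X ⟶ P ⊞ A) : t ≫ biprod.desc (pullback.lift E.i 0
        (by rw [← hf, reassoc_of% E.zero, zero_comp, zero_comp]))
        (pullback.lift (f := f) 0 U.i (by rw [U.zero, zero_comp])) ≫ pullback.fst f U.p =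
        t ≫ biprod.fst ≫ E.i := by
      congr 1
      apply biprod.hom_ext' <;> simp [pullback.lift_fst]
    have sndU (X : C) (t : X ⟶ P ⊞ A) : t ≫ biprod.desc (pullback.lift E.i 0
        (by rw [← hf, reassoc_of% E.zero, zero_comp, zero_comp]))
        (pullback.lift (f := f) 0 U.i (by rw [U.zero, zero_comp])) ≫ pullback.snd f U.p =
        t ≫ biprod.snd ≫ U.i := by
      congr 1
      apply biprod.hom_ext' <;> simp [pullback.lift_snd]
    refine { exact := ?_, mono_f := ?_, epi_g := ?_ }
    · rw [ShortComplex.exact_iff_exact_up_to_refinements]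
      intro X t ht
      change t ≫ pullback.fst f U.p ≫ E.p = 0 at ht
      obtain ⟨a, ha⟩ : ∃ a, a ≫ E.i = t ≫ pullback.fst f U.p :=
        ⟨_, E.exact.exact.lift_f (t ≫ pullback.fst f U.p) (by simpa using ht)⟩
      obtain ⟨b, hb⟩ : ∃ b, b ≫ U.i = t ≫ pullback.snd f U.p :=
        ⟨_, U.exact.exact.lift_f (t ≫ pullback.snd f U.p) (by
          change (t ≫ pullback.snd f U.p) ≫ U.p = 0
          rw [Category.assoc, ← pullback.condition, ← congrArg (pullback.fst f U.p ≫ ·) hf]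
          change t ≫ pullback.fst f U.p ≫ E.p ≫ q = 0
          rw [reassoc_of% ht, zero_comp])⟩
      refine ⟨X, 𝟙 X, inferInstance, biprod.lift a b, ?_⟩
      rw [Category.id_comp]
      apply pullback.hom_ext
      · rw [Category.assoc, fstE, biprod.lift_fst_assoc, ha]
      · rw [Category.assoc, sndU, biprod.lift_snd_assoc, hb]
    · change Mono (biprod.desc _ _)
      rw [Preadditive.mono_iff_cancel_zero]
      intro X t ht
      apply biprod.hom_ext
      · rw [zero_comp, ← cancel_mono E.i, zero_comp, Category.assoc, ← fstE, reassoc_of% ht,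
          zero_comp]
      · rw [zero_comp, ← cancel_mono U.i, zero_comp, Category.assoc, ← sndU, reassoc_of% ht,
          zero_comp]
    · exact epi_comp (pullback.fst f U.p) E.p

variable [HasExt.{w} C]

/-- An extension receiving a morphism from a fibre product of extensions over the identity
of `Q` is a Baer sum. -/
lemma cls_eq_add_of_fibreProduct {P' : C} (E : Extn Q P) (U : Extn B A) (q : Q ⟶ B)
    (f : E.obj ⟶ B) (hf : E.p ≫ q = f) (T : Extn Q P') (b : P ⟶ P') (c : A ⟶ P')
    (g : pullback f U.p ⟶ T.obj)
    (hb : ∀ h, pullback.lift E.i 0 h ≫ g = b ≫ T.i)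
    (hc : ∀ h, pullback.lift 0 U.i h ≫ g = c ≫ T.i)
    (hg : g ≫ T.p = pullback.fst f U.p ≫ E.p) :
    T.cls = push.{w} b E.cls + push c (pull q U.cls) := by
  -- The sum arises from `biprod.desc b c = biprod.fst ≫ b + biprod.snd ≫ c`, the class of `F`
  -- projecting to those of `E` and of the pullback of `U`.
  let F := E.fibreProduct U q f hf
  have h1 : push.{w} biprod.fst F.cls = pull (𝟙 Q) E.cls :=
    cls_naturality F E biprod.fst (pullback.fst f U.p) (𝟙 Q)
      (by apply biprod.hom_ext' <;> simp [F, fibreProduct, pullback.lift_fst]) (by simp [F, fibreProduct])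
  have h2 : push.{w} biprod.snd F.cls = pull q U.cls :=
    cls_naturality F U biprod.snd (pullback.snd f U.p) q
      (by apply biprod.hom_ext' <;> simp [F, fibreProduct, pullback.lift_snd])
      (by simp only [F, fibreProduct, Category.assoc, hf, pullback.condition])
  have h3 : push.{w} (biprod.desc b c) F.cls = pull (𝟙 Q) T.cls :=
    cls_naturality F T (biprod.desc b c) g (𝟙 Q)
      (by apply biprod.hom_ext' <;> simp [F, fibreProduct, hb, hc])
      (hg.trans (Category.comp_id _).symm)
  rw [pull_id] at h1 h3
  rw [← h1, ← h2, ← h3, push_push, push_push, ← push_add]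
  congr 2
  apply biprod.hom_ext' <;> simp

end Extn

namespace Blended

variable {A N B : C} {M₂ : Extn B N} {M₁ : Extn N A}

/-- The row `0 ⟶ A ⟶ M ⟶ M₂ ⟶ 0` of a blended extension. -/
abbrev rowExtn (M : Blended M₂ M₁) : Extn M₂.obj A := ⟨M.obj, _, _, _, M.row⟩

/-- The column `0 ⟶ M₁ ⟶ M ⟶ B ⟶ 0` of a blended extension. -/
abbrev colExtn (M : Blended M₂ M₁) : Extn B M₁.obj := ⟨M.obj, _, _, _, M.col⟩

/-- Modulo the antidiagonal, `(0, a)` and `(a, 0)` agree. -/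
lemma lift_zero_comp_cokernel_π (M : Blended M₂ M₁) (U : Extn B A) (h) :
    pullback.lift 0 U.i h ≫ cokernel.π (M.antidiag U) = M₁.i ≫ M.trι U := by
  have h1 : M₁.i ≫ M.inlFib U - pullback.lift 0 U.i h = M.antidiag U := by
    apply pullback.hom_ext
    · simp [inlFib_fst, antidiag_fst, incl, pullback.lift_fst]
    · simp [inlFib_snd, antidiag_snd, pullback.lift_snd]
  have h2 := cokernel.condition (M.antidiag U)
  rw [← h1, Preadditive.sub_comp, sub_eq_zero, Category.assoc, h1] at h2
  exact h2.symm

variable [HasExt.{w} C]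

/-- The class of the row of a blended extension. -/
noncomputable def rowCls (M : Blended M₂ M₁) : Ext.{w} M₂.obj A 1 := M.rowExtn.cls

/-- The class of the column of a blended extension. -/
noncomputable def colCls (M : Blended M₂ M₁) : Ext.{w} B M₁.obj 1 := M.colExtn.cls

/-- `M ×_B U` is an extension of `M₂` by `A ⊞ A`, and dividing by the antidiagonal induces the sum
map `A ⊞ A ⟶ A`. -/
lemma rowCls_translate (M : Blended M₂ M₁) (U : Extn B A) :
    (M.translate U).rowCls = M.rowCls + pull.{w} M₂.p U.cls := by
  have h := Extn.cls_eq_add_of_fibreProduct.{w} M.rowExtn U M₂.p M.proj rfl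
    (M.translate U).rowExtn (𝟙 A) (𝟙 A) (cokernel.π (M.antidiag U)) ?_ ?_ (M.coker_trπ U)
  · rwa [push_id, push_id] at h
  · intro h
    rw [Category.id_comp]
    change _ = M₁.i ≫ M.trι U
    rw [trι, ← Category.assoc]
    congr 1
    apply pullback.hom_ext
    · rw [Category.assoc, inlFib_fst, pullback.lift_fst]
    · rw [Category.assoc, inlFib_snd, pullback.lift_snd, comp_zero]
  · intro h
    rw [Category.id_comp]
    exact M.lift_zero_comp_cokernel_π U h

/-- The same fibre product, viewed as an extension of `B` by `M₁ ⊞ A`. -/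
lemma colCls_translate (M : Blended M₂ M₁) (U : Extn B A) :
    (M.translate U).colCls = M.colCls + push.{w} M₁.i U.cls := by
  have h := Extn.cls_eq_add_of_fibreProduct.{w} M.colExtn U (𝟙 B) M.proj (Category.comp_id _)
    (M.translate U).colExtn (𝟙 _) M₁.i (cokernel.π (M.antidiag U)) ?_ ?_ ?_
  · rwa [push_id, pull_id] at h
  · intro h
    rw [Category.id_comp]
    rfl
  · exact M.lift_zero_comp_cokernel_π U
  · change cokernel.π (M.antidiag U) ≫ M.trπ U ≫ M₂.p = _
    rw [reassoc_of% M.coker_trπ U]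

lemma pull_rowCls (M : Blended M₂ M₁) : pull.{w} M₂.i M.rowCls = M₁.cls := by
  have h := Extn.cls_naturality.{w} M₁ M.rowExtn (𝟙 A) M.ι M₂.i (Category.id_comp _).symm M.comm
  rw [push_id] at h
  exact h.symm

/-- All rows restrict to the class of `M₁` along `N ⟶ M₂`, so their differences come from `B`. -/
lemma exists_rowCls_eq_add (M M' : Blended M₂ M₁) :
    ∃ u : Ext.{w} B A 1, M'.rowCls = M.rowCls + pull M₂.p u := by
  obtain ⟨u, hu⟩ := Ext.contravariant_sequence_exact₂ M₂.exact A (M'.rowCls - M.rowCls)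
    (show pull M₂.i (M'.rowCls - M.rowCls) = 0 by
      rw [map_sub, pull_rowCls, pull_rowCls, sub_self])
  refine ⟨u, ?_⟩
  rw [pull_def]
  erw [hu]
  abel

lemma rowCls_eq_of_isIsomorphic {M M' : Blended M₂ M₁} (h : IsIsomorphic M M') :
    M.rowCls = (M'.rowCls : Ext.{w} _ _ 1) := by
  obtain ⟨e, h1, h2⟩ := h
  have h := Extn.cls_naturality.{w} M.rowExtn M'.rowExtn (𝟙 A) e.hom (𝟙 _)
    (by
      change (M₁.i ≫ M.ι) ≫ e.hom = 𝟙 A ≫ M₁.i ≫ M'.ι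
      rw [Category.assoc, h1, Category.id_comp])
    (h2.trans (Category.comp_id _).symm)
  rwa [push_id, pull_id] at h

end Blended

variable [HasExt.{w} C]

/-- The kernel is the image of `Hom(N, A)` under the connecting map. -/
lemma pull_p_injective {A N B : C} (M₂ : Extn B N) (hNA : ∀ f : N ⟶ A, f = 0) :
    Function.Injective (pull.{w} (P := A) M₂.p) := by
  rw [injective_iff_map_eq_zero]
  intro u hu
  obtain ⟨f, hf⟩ := Ext.contravariant_sequence_exact₃ M₂.exact A u hu (add_zero 1)
  obtain ⟨f, rfl⟩ := (Ext.mk₀_bijective _ _).2 f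
  rw [← hf]
  have : f = 0 := hNA f
  rw [this, Ext.mk₀_zero, Ext.comp_zero]

/-- An isomorphism of rows respects `A` and `M₂`. On `M₁` it can fail to be the identity only by a
morphism factoring as `M₁ ⟶ N ⟶ A ⟶ M'`, hence by zero. -/
lemma Blended.isIsomorphic_of_rowCls_eq {A N B : C} {M₂ : Extn B N} {M₁ : Extn N A}
    (hNA : ∀ f : N ⟶ A, f = 0) {M M' : Blended M₂ M₁}
    (h : M.rowCls = (M'.rowCls : Ext.{w} _ _ 1)) : IsIsomorphic M M' := by
  obtain ⟨f, hi, hp⟩ := Extn.exists_hom.{w} M.rowExtn M'.rowExtn (𝟙 A) (𝟙 _) (by simpa [rowCls] using h)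
  rw [Category.id_comp] at hi
  rw [Category.comp_id] at hp
  have := Extn.isIso_hom _ _ f hi hp
  refine ⟨asIso f, ?_, hp⟩
  change M.ι ≫ f = M'.ι
  replace hi : (M₁.i ≫ M.ι) ≫ f = M₁.i ≫ M'.ι := hi
  replace hp : f ≫ M'.π = M.π := hp
  have hepi : Epi M₁.p := M₁.exact.epi_g
  have hmono : Mono (M₁.i ≫ M'.ι) := M'.row.mono_f
  obtain ⟨d, hd⟩ : ∃ d : N ⟶ M'.obj, M₁.p ≫ d = M.ι ≫ f - M'.ι :=
    M₁.exact.exact.desc' (M.ι ≫ f - M'.ι) (by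
      change M₁.i ≫ _ = 0
      rw [Preadditive.comp_sub, ← Category.assoc, hi, sub_self])
  have hd' : d ≫ M'.π = 0 := by
    rw [← cancel_epi M₁.p, comp_zero, reassoc_of% hd, Preadditive.sub_comp, Category.assoc, hp,
      M.comm, M'.comm, sub_self]
  obtain ⟨t, ht⟩ : ∃ t : N ⟶ A, t ≫ M₁.i ≫ M'.ι = d := ⟨_, M'.row.exact.lift_f d hd'⟩
  rw [← sub_eq_zero, ← hd, ← ht, hNA t, zero_comp, comp_zero]

end BlendedClasses

/-! ### Transposition of morphisms and biduality -/

section Transposition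

variable {C : Type u} [Category.{v} C] [MonoidalCategory C] [RightRigidCategory C]

lemma tr_comp {X Y Z : C} (f : X ⟶ Y) (g : Y ⟶ Z) : tr (f ≫ g) = tr g ≫ tr f :=
  comp_rightAdjointMate

lemma tr_id (X : C) : tr (𝟙 X) = 𝟙 (dual X) := rightAdjointMate_id

/-- The transpose of an isomorphism. -/
@[simps]
def trIso {X Y : C} (e : X ≅ Y) : dual Y ≅ dual X where
  hom := tr e.hom
  inv := tr e.inv
  hom_inv_id := by rw [← tr_comp, e.inv_hom_id, tr_id]
  inv_hom_id := by rw [← tr_comp, e.hom_inv_id, tr_id]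

/-- Morphisms to a dual object are determined by the induced pairings. -/
lemma dual_hom_ext {Z X : C} {f g : Z ⟶ dual X}
    (h : f ▷ X ≫ ε_ X (dual X) = g ▷ X ≫ ε_ X (dual X)) : f = g := by
  apply (cancel_mono (λ_ (dual X)).inv).1
  rw [← tensorRightHomEquiv_whiskerRight_comp_evaluation,
    ← tensorRightHomEquiv_whiskerRight_comp_evaluation, h]

section Braided

variable [BraidedCategory C]

lemma bidual_hom_comp_evaluation (X : C) :
    (bidual X).hom ▷ dual X ≫ ε_ (dual X) (dual (dual X)) =
      (β_ X (dual X)).hom ≫ ε_ X (dual X) := by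
  let := BraidedCategory.exactPairing_swap X (dual X)
  exact @rightAdjointMate_comp_evaluation C _ _ (dual X) (dual X) ⟨dual (dual X)⟩ ⟨X⟩ (𝟙 _) |>.trans
    (by rw [MonoidalCategory.whiskerLeft_id, Category.id_comp]; rfl)

lemma transpose_comp {X Y Z : C} (f : X ⟶ Y) (g : Y ⟶ dual Z) :
    transpose (f ≫ g) = transpose g ≫ tr f := by
  rw [transpose, transpose, tr_comp, Category.assoc]

lemma transpose_comp_tr {X Y Z : C} (f : X ⟶ dual Y) (g : Z ⟶ Y) :
    transpose (f ≫ tr g) = g ≫ transpose f := by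
  rw [transpose, transpose, tr_comp, ← Category.assoc, ← bidual_naturality, Category.assoc]

end Braided

/-- As pairings, each biduality map contributes one braiding, and symmetry makes the two cancel. -/
lemma bidual_dual_hom_comp_tr [SymmetricCategory C] (X : C) :
    (bidual (dual X)).hom ≫ tr (bidual X).hom = 𝟙 (dual X) := by
  apply dual_hom_ext
  rw [comp_whiskerRight, Category.assoc, rightAdjointMate_comp_evaluation,
    ← whisker_exchange_assoc, bidual_hom_comp_evaluation,
    BraidedCategory.braiding_naturality_right_assoc, bidual_hom_comp_evaluation,
    SymmetricCategory.symmetry_assoc, id_whiskerRight, Category.id_comp]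

lemma transpose_transpose [SymmetricCategory C] {X Y : C} (f : X ⟶ dual Y) :
    transpose (transpose f) = f := by
  conv_lhs => rw [transpose, transpose]
  rw [tr_comp, ← Category.assoc, ← bidual_naturality, Category.assoc, bidual_dual_hom_comp_tr,
    Category.comp_id]

section Additive

variable [Abelian C] [MonoidalPreadditive C]

lemma tr_add {X Y : C} (f g : X ⟶ Y) : tr (f + g) = tr f + tr g := by
  apply dual_hom_ext
  simp only [MonoidalPreadditive.add_whiskerRight, Preadditive.add_comp,
    rightAdjointMate_comp_evaluation, MonoidalPreadditive.whiskerLeft_add]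

lemma tr_neg {X Y : C} (f : X ⟶ Y) : tr (-f) = -tr f := by
  rw [eq_neg_iff_add_eq_zero, ← tr_add, neg_add_cancel, tr_zero]

lemma tr_units_smul {X Y : C} (ε : ℤˣ) (f : X ⟶ Y) : tr ((ε : ℤ) • f) = (ε : ℤ) • tr f := by
  rcases Int.units_eq_one_or ε with rfl | rfl <;> simp [tr_neg]

lemma transpose_units_smul [BraidedCategory C] {X Y : C} (ε : ℤˣ) (f : X ⟶ dual Y) :
    transpose ((ε : ℤ) • f) = (ε : ℤ) • transpose f := by
  rw [transpose, transpose, tr_units_smul, Preadditive.comp_zsmul]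

end Additive

end Transposition

/-! ### Duality as a homomorphism on `Ext¹` -/

section DualClass

variable {C : Type u} [Category.{v} C] [MonoidalCategory C] [RightRigidCategory C]
  [Abelian C] [MonoidalPreadditive C] [BraidedCategory C] [HasExt.{w} C]

lemma Extn.dual_cls_naturality {Q P Q' P' : C} (E : Extn Q P) (E' : Extn Q' P') (b : P ⟶ P')
    (a : Q ⟶ Q') (h : push.{w} b E.cls = pull a E'.cls) :
    pull (tr b) E.dual.cls = push.{w} (tr a) E'.dual.cls := by
  obtain ⟨f, hi, hp⟩ := Extn.exists_hom E E' b a h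
  refine (Extn.cls_naturality E'.dual E.dual (tr a) (tr f) (tr b) ?_ ?_).symm
  · change tr E'.p ≫ tr f = tr a ≫ tr E.p
    rw [← tr_comp, hp, tr_comp]
  · change tr f ≫ tr E.i = tr E'.i ≫ tr b
    rw [← tr_comp, hi, tr_comp]

/-- The class of the dual of an extension with a given class. -/
noncomputable def dualCls {Q P : C} (x : Ext.{w} Q P 1) : Ext.{w} (dual P) (dual Q) 1 :=
  (Extn.exists_cls x).choose.dual.cls

/-- Independence of the chosen representative: equal classes are joined by a morphism of extensions,
which can be transposed. -/
lemma dualCls_cls {Q P : C} (E : Extn Q P) : dualCls.{w} E.cls = E.dual.cls := by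
  have h := Extn.dual_cls_naturality.{w} (Extn.exists_cls.{w} E.cls).choose E (𝟙 P) (𝟙 Q)
    (by rw [push_id, pull_id]; exact (Extn.exists_cls E.cls).choose_spec)
  rwa [tr_id, tr_id, push_id, pull_id] at h

lemma dualCls_naturality {Q P Q' P' : C} (b : P ⟶ P') (a : Q ⟶ Q') {x : Ext.{w} Q P 1}
    {y : Ext.{w} Q' P' 1} (h : push b x = pull a y) :
    pull (tr b) (dualCls x) = push (tr a) (dualCls y) := by
  obtain ⟨E, rfl⟩ := Extn.exists_cls x
  obtain ⟨E', rfl⟩ := Extn.exists_cls y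
  rw [dualCls_cls, dualCls_cls]
  exact Extn.dual_cls_naturality E E' b a h

lemma dualCls_push {Q P P' : C} (b : P ⟶ P') (x : Ext.{w} Q P 1) :
    dualCls (push b x) = pull (tr b) (dualCls x) := by
  rw [dualCls_naturality b (𝟙 Q) (x := x) (y := push b x) (by rw [pull_id]), tr_id, push_id]

/-- Both classes are projections of one class `z` with coefficients in `P ⊞ P`, so additivity
reduces to that of `tr` and of `pull`. -/
lemma dualCls_add {Q P : C} (x y : Ext.{w} Q P 1) :
    dualCls (x + y) = dualCls x + dualCls y := by
  let z : Ext.{w} Q (P ⊞ P) 1 := push biprod.inl x + push biprod.inr y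
  have hx : x = push biprod.fst z := by simp [z]
  have hy : y = push biprod.snd z := by simp [z]
  conv_lhs => rw [hx, hy, ← push_add, dualCls_push, tr_add, pull_add, ← dualCls_push,
    ← dualCls_push, ← hx, ← hy]

/-- The homomorphism of `Ext¹(B, dual B)` given by the duality of extensions. -/
noncomputable def dualSelfHom (B : C) : Ext.{w} B (dual B) 1 →+ Ext.{w} B (dual B) 1 :=
  AddMonoidHom.mk' (fun x => pull (bidual B).hom (dualCls x))
    (fun x y => by rw [dualCls_add, map_add])

lemma dualSelfHom_cls {B : C} (U : Extn B (dual B)) :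
    dualSelfHom.{w} B U.cls = U.dualSelf.cls := by
  have h := Extn.cls_naturality.{w} U.dualSelf U.dual (𝟙 _) (𝟙 _) (bidual B).hom
    ((Category.comp_id _).trans (Category.id_comp _).symm)
    (by
      change 𝟙 _ ≫ U.dual.p = (U.dual.p ≫ (bidual B).inv) ≫ (bidual B).hom
      rw [Category.id_comp, Category.assoc, Iso.inv_hom_id, Category.comp_id])
  rw [push_id] at h
  rw [h, ← dualCls_cls]
  rfl

lemma mem_extSign_iff {ε : ℤˣ} {B : C} {x : Ext.{w} B (dual B) 1} :
    x ∈ extSign ε B ↔ dualSelfHom B x = (ε : ℤ) • x := by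
  constructor
  · rintro ⟨U, rfl, h⟩
    rw [dualSelfHom_cls, h]
  · intro h
    obtain ⟨U, rfl⟩ := Extn.exists_cls x
    exact ⟨U, rfl, by rw [← dualSelfHom_cls, h]⟩

end DualClass

/-! ### The involution on blended extensions defined by `Φ` -/

section Symmetry

variable {C : Type u} [Category.{v} C] [MonoidalCategory C] [RightRigidCategory C]
  [Abelian C] [SymmetricCategory C]
  {A N B : C}

/-- An `ε`-symmetric isomorphism of the extension `M₁` with the dual of `M₂`, together with
the transposed isomorphism of `M₂` with the dual of `M₁`. -/
structure SymmetricDuality (ε : ℤˣ) (M₁ : Extn N A) (M₂ : Extn B N) where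
  /-- the isomorphism of the subobject -/
  lam : A ≅ dual B
  /-- the isomorphism of the middle objects -/
  Φ : M₁.obj ≅ dual M₂.obj
  /-- `ε` times the transpose of `Φ` -/
  Θ : M₂.obj ≅ dual M₁.obj
  /-- `ε` times the transpose of `lam` -/
  μ : B ≅ dual A
  hΘ : Θ.hom = (ε : ℤ) • transpose Φ.hom
  hμ : μ.hom = (ε : ℤ) • transpose lam.hom
  i_Φ : M₁.i ≫ Φ.hom = lam.hom ≫ tr M₂.p
  Θ_p : Θ.hom ≫ tr M₁.i = M₂.p ≫ μ.hom
  comm : M₁.p ≫ M₂.i ≫ Θ.hom = Φ.hom ≫ tr M₂.i ≫ tr M₁.p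

/-- An isomorphism multiplied by a sign. -/
@[simps]
def unitsSMulIso {X Y : C} (ε : ℤˣ) (e : X ≅ Y) : X ≅ Y where
  hom := (ε : ℤ) • e.hom
  inv := (ε : ℤ) • e.inv
  hom_inv_id := by rcases Int.units_eq_one_or ε with rfl | rfl <;> simp
  inv_hom_id := by rcases Int.units_eq_one_or ε with rfl | rfl <;> simp

lemma hom_dual_eq_zero [MonoidalPreadditive C] (lam : A ≅ dual B) (hNA : ∀ f : N ⟶ A, f = 0) (f : B ⟶ dual N) : f = 0 := by
  have h : transpose f = 0 := by
    rw [← cancel_mono lam.inv, zero_comp]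
    exact hNA _
  rw [← transpose_transpose f, h, transpose, tr_zero, comp_zero]

namespace SymmetricDuality

variable {ε : ℤˣ} {M₁ : Extn N A} {M₂ : Extn B N} (D : SymmetricDuality ε M₁ M₂)

lemma p_μ_inv : M₂.p = D.Θ.hom ≫ tr M₁.i ≫ D.μ.inv := by
  rw [← Category.assoc, D.Θ_p, Category.assoc, Iso.hom_inv_id, Category.comp_id]

section

variable [HasExt.{w} C]

/-- The class in `Ext¹(M₂, dual B)` of the row of a blended extension. -/
noncomputable def rowClass : Extpan M₂ M₁ → Ext.{w} M₂.obj (dual B) 1 :=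
  Quotient.lift (fun M => push D.lam.hom M.rowCls)
    fun _ _ h => congrArg _ (Blended.rowCls_eq_of_isIsomorphic h)

lemma rowClass_cls (M : Blended M₂ M₁) :
    D.rowClass.{w} M.cls = push D.lam.hom M.rowCls := rfl

lemma rowClass_injective (hNA : ∀ f : N ⟶ A, f = 0) :
    Function.Injective D.rowClass.{w} := by
  intro x y h
  obtain ⟨M, rfl⟩ := Quotient.exists_rep x
  obtain ⟨M', rfl⟩ := Quotient.exists_rep y
  replace h := congrArg (push D.lam.inv) h
  refine Quotient.sound (Blended.isIsomorphic_of_rowCls_eq.{w} hNA ?_)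
  change push D.lam.inv (push D.lam.hom M.rowCls) = push D.lam.inv (push D.lam.hom M'.rowCls) at h
  simpa using h

lemma rowClass_translate (M : Blended M₂ M₁) (U : Extn B A) :
    D.rowClass.{w} (M.translate U).cls =
      D.rowClass M.cls + pull M₂.p (push D.lam.hom U.cls) := by
  rw [rowClass_cls, rowClass_cls, Blended.rowCls_translate, map_add, pull_push]

lemma exists_rowClass_eq_add (x y : Extpan M₂ M₁) :
    ∃ u : Ext.{w} B (dual B) 1, D.rowClass y = D.rowClass x + pull M₂.p u := by
  obtain ⟨M, rfl⟩ := Quotient.exists_rep x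
  obtain ⟨M', rfl⟩ := Quotient.exists_rep y
  obtain ⟨u, hu⟩ := Blended.exists_rowCls_eq_add.{w} M M'
  refine ⟨push D.lam.hom u, ?_⟩
  change push D.lam.hom M'.rowCls = push D.lam.hom M.rowCls + _
  rw [hu, map_add, pull_push]

lemma exists_translate (u : Ext.{w} B (dual B) 1) : ∃ U : Extn B A, push D.lam.hom U.cls = u := by
  obtain ⟨U, hU⟩ := Extn.exists_cls (push D.lam.inv u)
  exact ⟨U, by simp [hU]⟩

end

variable [MonoidalPreadditive C]

lemma transpose_Θ : transpose D.Θ.hom = (ε : ℤ) • D.Φ.hom := by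
  rw [D.hΘ, transpose_units_smul, transpose_transpose]

lemma Φ_tr_Θ_inv : D.Φ.hom ≫ tr D.Θ.inv = (ε : ℤ) • (bidual M₁.obj).hom := by
  have h : (bidual M₁.obj).hom ≫ tr D.Θ.hom = (ε : ℤ) • D.Φ.hom := D.transpose_Θ
  rw [← cancel_mono (trIso D.Θ).hom, Category.assoc]
  change D.Φ.hom ≫ (trIso D.Θ).inv ≫ (trIso D.Θ).hom = _ ≫ tr D.Θ.hom
  rw [Iso.inv_hom_id, Category.comp_id, Preadditive.zsmul_comp, h, smul_smul]
  rcases Int.units_eq_one_or ε with rfl | rfl <;> simp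

/-- The dual of a blended extension of `M₂` by `M₁`, as a blended extension of `M₂` by `M₁`. -/
def dualBlended (M : Blended M₂ M₁) : Blended M₂ M₁ where
  obj := dual M.obj
  ι := D.Φ.hom ≫ tr M.π
  π := tr M.ι ≫ D.Θ.inv
  comm := by
    rw [Category.assoc, ← Category.assoc (tr M.π), ← tr_comp, M.comm, tr_comp, Category.assoc,
      ← cancel_mono D.Θ.hom]
    simp only [Category.assoc, Iso.inv_hom_id, Category.comp_id, D.comm]
  row_zero := by
    rw [← Category.assoc M₁.i, D.i_Φ]
    have h : tr M₂.p ≫ tr M.π ≫ tr M.ι = 0 := by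
      rw [← tr_comp, ← tr_comp, Category.assoc, M.col_zero, tr_zero]
    simp only [Category.assoc]
    rw [reassoc_of% h, zero_comp, comp_zero]
  row := ShortComplex.shortExact_of_iso (S₁ := ShortComplex.mk _ _ M.dual.row_zero)
    (ShortComplex.isoMk D.lam.symm (Iso.refl _) D.Θ.symm
      (by
        change D.lam.inv ≫ M₁.i ≫ D.Φ.hom ≫ tr M.π = (tr M₂.p ≫ tr M.π) ≫ 𝟙 _
        rw [← Category.assoc M₁.i, D.i_Φ, Category.comp_id, Category.assoc,
          Iso.inv_hom_id_assoc])
      (by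
        change 𝟙 _ ≫ tr M.ι ≫ D.Θ.inv = tr M.ι ≫ D.Θ.inv
        rw [Category.id_comp])) M.dual.row
  col_zero := by
    rw [D.p_μ_inv]
    have h : tr M.π ≫ tr M.ι ≫ tr M₁.i = 0 := by
      rw [← tr_comp, ← tr_comp, M.row_zero, tr_zero]
    simp only [Category.assoc, Iso.inv_hom_id_assoc]
    rw [reassoc_of% h, zero_comp, comp_zero]
  col := ShortComplex.shortExact_of_iso (S₁ := ShortComplex.mk _ _ M.dual.col_zero)
    (ShortComplex.isoMk D.Φ.symm (Iso.refl _) D.μ.symm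
      (by
        change D.Φ.inv ≫ D.Φ.hom ≫ tr M.π = tr M.π ≫ 𝟙 _
        rw [Category.comp_id, Iso.inv_hom_id_assoc])
      (by
        change 𝟙 _ ≫ (tr M.ι ≫ D.Θ.inv) ≫ M₂.p = (tr M.ι ≫ tr M₁.i) ≫ D.μ.inv
        rw [D.p_μ_inv]
        simp)) M.dual.col

lemma dualBlended_isIsomorphic {M M' : Blended M₂ M₁} (h : M.IsIsomorphic M') :
    (D.dualBlended M).IsIsomorphic (D.dualBlended M') := by
  obtain ⟨e, h1, h2⟩ := h
  refine ⟨trIso e.symm, ?_, ?_⟩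
  · change (D.Φ.hom ≫ tr M.π) ≫ tr e.inv = D.Φ.hom ≫ tr M'.π
    rw [Category.assoc, ← tr_comp, ← h2, e.inv_hom_id_assoc]
  · change tr e.inv ≫ tr M'.ι ≫ D.Θ.inv = tr M.ι ≫ D.Θ.inv
    rw [← Category.assoc, ← tr_comp, ← h1, Category.assoc, e.hom_inv_id, Category.comp_id]

/-- The sign in the isomorphism compensates the one in `Θ = ε ᵗΦ`. -/
lemma isIsomorphic_dualBlended_dualBlended (M : Blended M₂ M₁) :
    M.IsIsomorphic (D.dualBlended (D.dualBlended M)) := by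
  refine ⟨unitsSMulIso ε (bidual M.obj), ?_, ?_⟩
  · change M.ι ≫ ((ε : ℤ) • (bidual M.obj).hom) = D.Φ.hom ≫ tr (tr M.ι ≫ D.Θ.inv)
    rw [tr_comp, ← Category.assoc, D.Φ_tr_Θ_inv, Preadditive.zsmul_comp, Preadditive.comp_zsmul,
      bidual_naturality]
  · change ((ε : ℤ) • (bidual M.obj).hom) ≫ tr (D.Φ.hom ≫ tr M.π) ≫ D.Θ.inv = M.π
    rw [tr_comp, Preadditive.zsmul_comp, ← Category.assoc, ← Category.assoc,
      ← bidual_naturality, ← Preadditive.zsmul_comp, Category.assoc M.π,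
      ← Preadditive.comp_zsmul]
    change (M.π ≫ ((ε : ℤ) • transpose D.Φ.hom)) ≫ D.Θ.inv = M.π
    rw [← D.hΘ, Category.assoc, Iso.hom_inv_id, Category.comp_id]

lemma isSelfDual_iff (hNA : ∀ f : N ⟶ A, f = 0) (M : Blended M₂ M₁) :
    M.IsSelfDual ε D.lam.hom D.Φ.hom ↔ M.IsIsomorphic (D.dualBlended M) := by
  constructor
  · rintro ⟨ψ, h1, h2⟩
    change M.obj ⟶ dual M.obj at ψ
    change M.ι ≫ ψ = D.Φ.hom ≫ tr M.π at h1
    rw [← D.hμ] at h2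
    change ψ ≫ tr M.ι ≫ tr M₁.i = (M.π ≫ M₂.p) ≫ D.μ.hom at h2
    have hepi : Epi (M.π ≫ M₂.p) := M.col.epi_g
    -- The difference of the two sides vanishes on `M₁` and after projection to `dual A`, so it
    -- factors through a morphism `B ⟶ dual N`, which is zero.
    have h3 : ψ ≫ tr M.ι = M.π ≫ D.Θ.hom := by
      obtain ⟨d, hd⟩ : ∃ d, (M.π ≫ M₂.p) ≫ d = ψ ≫ tr M.ι - M.π ≫ D.Θ.hom :=
        M.col.exact.desc' (ψ ≫ tr M.ι - M.π ≫ D.Θ.hom) (by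
          change M.ι ≫ _ = 0
          rw [Preadditive.comp_sub, reassoc_of% h1, ← tr_comp, M.comm, tr_comp, ← D.comm,
            reassoc_of% M.comm, sub_self])
      have hd' : d ≫ tr M₁.i = 0 := by
        rw [← cancel_epi (M.π ≫ M₂.p), comp_zero, ← Category.assoc, hd, Preadditive.sub_comp,
          Category.assoc, h2, Category.assoc M.π D.Θ.hom, D.Θ_p, Category.assoc, sub_self]
      obtain ⟨e, rfl⟩ : ∃ e, e ≫ tr M₁.p = d := dual_lift M₁.exact d hd'
      rw [← sub_eq_zero, ← hd, hom_dual_eq_zero D.lam hNA e, zero_comp, comp_zero]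
    have h4 : ψ ≫ tr M.ι ≫ D.Θ.inv = M.π := by
      rw [reassoc_of% h3, Iso.hom_inv_id, Category.comp_id]
    have : IsIso ψ := Extn.isIso_hom M.colExtn (D.dualBlended M).colExtn ψ h1 (by
      change ψ ≫ (tr M.ι ≫ D.Θ.inv) ≫ M₂.p = M.π ≫ M₂.p
      rw [← h4]
      simp only [Category.assoc])
    exact ⟨@asIso _ _ M.obj (D.dualBlended M).obj ψ this, h1, h4⟩
  · rintro ⟨e, h1, h2⟩
    refine ⟨e.hom, h1, ?_⟩
    rw [← D.hμ]
    change e.hom ≫ tr M.ι ≫ D.Θ.inv = M.π at h2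
    change e.hom ≫ tr M.ι ≫ tr M₁.i = (M.π ≫ M₂.p) ≫ D.μ.hom
    rw [Category.assoc, ← D.Θ_p, ← h2, Category.assoc]
    have h3 : tr M.ι ≫ tr M₁.i = (tr M.ι ≫ D.Θ.inv) ≫ D.Θ.hom ≫ tr M₁.i := by
      rw [Category.assoc, Iso.inv_hom_id_assoc]
    exact congrArg (e.hom ≫ ·) h3

/-- The duality of blended extensions on isomorphism classes. -/
def dualExtpan : Extpan M₂ M₁ → Extpan M₂ M₁ :=
  Quotient.map D.dualBlended fun _ _ => D.dualBlended_isIsomorphic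

lemma dualExtpan_dualExtpan (x : Extpan M₂ M₁) : D.dualExtpan (D.dualExtpan x) = x := by
  obtain ⟨M, rfl⟩ := Quotient.exists_rep x
  exact (Quotient.sound (D.isIsomorphic_dualBlended_dualBlended M)).symm

lemma mem_extpanaut_iff (hNA : ∀ f : N ⟶ A, f = 0) (x : Extpan M₂ M₁) :
    x ∈ extpanaut ε D.lam.hom D.Φ.hom ↔ D.dualExtpan x = x := by
  constructor
  · rintro ⟨M, rfl, h⟩
    exact (Quotient.sound ((D.isSelfDual_iff hNA M).1 h)).symm
  · obtain ⟨M, rfl⟩ := Quotient.exists_rep x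
    intro h
    exact ⟨M, rfl, (D.isSelfDual_iff hNA M).2 (Quotient.exact h.symm)⟩

variable [HasExt.{w} C]

/-- The row of the dual is the transposed column, up to the identifications `lam` and `Θ`. -/
lemma push_rowCls_dualBlended (M : Blended M₂ M₁) :
    push.{w} D.lam.hom (D.dualBlended M).rowCls = pull D.Θ.hom (dualCls M.colCls) := by
  rw [Blended.colCls, dualCls_cls]
  refine Extn.cls_naturality.{w} (D.dualBlended M).rowExtn M.colExtn.dual D.lam.hom (𝟙 _)
    D.Θ.hom ?_ ?_
  · change (M₁.i ≫ D.Φ.hom ≫ tr M.π) ≫ 𝟙 _ = D.lam.hom ≫ tr (M.π ≫ M₂.p)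
    rw [Category.comp_id, ← Category.assoc, D.i_Φ, Category.assoc, tr_comp]
  · change 𝟙 _ ≫ tr M.ι = (tr M.ι ≫ D.Θ.inv) ≫ D.Θ.hom
    rw [Category.id_comp, Category.assoc, Iso.inv_hom_id, Category.comp_id]

/-- Since `Θ` followed by `ᵗj` is `M₂ ⟶ B` followed by `ε ᵗlam`, the dual of a class pushed into
`M₁` comes from `B`; this is the source of the sign in `τ`. -/
lemma pull_dualCls_push (u : Ext.{w} B A 1) :
    pull D.Θ.hom (dualCls (push M₁.i u)) =
      pull M₂.p ((ε : ℤ) • dualSelfHom B (push D.lam.hom u)) := by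
  rw [dualCls_push, pull_pull, D.Θ_p, ← pull_pull, D.hμ, pull_units_smul]
  change _ = pull M₂.p ((ε : ℤ) • pull (bidual B).hom (dualCls (push D.lam.hom u)))
  rw [dualCls_push, pull_pull]
  rfl

lemma push_rowCls_dualBlended_translate (M : Blended M₂ M₁) (U : Extn B A) :
    push.{w} D.lam.hom (D.dualBlended (M.translate U)).rowCls =
      push D.lam.hom (D.dualBlended M).rowCls +
        pull M₂.p ((ε : ℤ) • dualSelfHom B (push D.lam.hom U.cls)) := by
  rw [push_rowCls_dualBlended, push_rowCls_dualBlended, Blended.colCls_translate, dualCls_add,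
    map_add, pull_dualCls_push]

lemma rowClass_dualExtpan (hNA : ∀ f : N ⟶ A, f = 0) (x y : Extpan M₂ M₁)
    (u : Ext.{w} B (dual B) 1) (h : D.rowClass y = D.rowClass x + pull M₂.p u) :
    D.rowClass (D.dualExtpan y) =
      D.rowClass (D.dualExtpan x) + pull M₂.p ((ε : ℤ) • dualSelfHom B u) := by
  obtain ⟨M, rfl⟩ := Quotient.exists_rep x
  obtain ⟨U, rfl⟩ := D.exists_translate u
  obtain rfl : y = (M.translate U).cls :=
    D.rowClass_injective.{w} hNA (h.trans (D.rowClass_translate M U).symm)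
  exact D.push_rowCls_dualBlended_translate M U

end SymmetricDuality

/-- `Φ` is invertible by the five lemma. The relations for `Θ` are `ε` times the transposes of those
for `Φ`; the one on `N` uses `ᵗφ = εφ` and `ε² = 1`. -/
lemma exists_symmetricDuality [MonoidalPreadditive C] {M₁ : Extn N A} {M₂ : Extn B N} (ε : ℤˣ) (φ : N ≅ dual N)
    (lam : A ≅ dual B) (hφ : transpose φ.hom = (ε : ℤ) • φ.hom) (Φ : M₁.obj ⟶ dual M₂.obj)
    (hΦA : M₁.i ≫ Φ = lam.hom ≫ tr M₂.p) (hΦN : Φ ≫ tr M₂.i = M₁.p ≫ φ.hom) :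
    ∃ D : SymmetricDuality ε M₁ M₂, D.lam = lam ∧ D.Φ.hom = Φ := by
  let f : ShortComplex.mk _ _ M₁.zero ⟶ ShortComplex.mk _ _ M₂.dual.zero :=
    ShortComplex.Hom.mk lam.hom Φ φ.hom hΦA.symm hΦN
  have h₁ : IsIso f.τ₁ := inferInstanceAs (IsIso lam.hom)
  have h₃ : IsIso f.τ₃ := inferInstanceAs (IsIso φ.hom)
  have hΦ : IsIso Φ :=
    ShortComplex.isIso₂_of_shortExact_of_isIso₁₃ f M₁.exact M₂.dual.exact
  refine ⟨{
    lam := lam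
    Φ := @asIso _ _ _ _ Φ hΦ
    Θ := unitsSMulIso ε (bidual M₂.obj ≪≫ trIso (@asIso _ _ _ _ Φ hΦ))
    μ := unitsSMulIso ε (bidual B ≪≫ trIso lam)
    hΘ := rfl
    hμ := rfl
    i_Φ := hΦA
    Θ_p := ?_
    comm := ?_ }, rfl, rfl⟩
  · change ((ε : ℤ) • transpose Φ) ≫ tr M₁.i = M₂.p ≫ ((ε : ℤ) • transpose lam.hom)
    have h := congrArg transpose hΦA
    rw [transpose_comp, transpose_comp_tr] at h
    rw [Preadditive.zsmul_comp, Preadditive.comp_zsmul, h]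
  · change M₁.p ≫ M₂.i ≫ ((ε : ℤ) • transpose Φ) = Φ ≫ tr M₂.i ≫ tr M₁.p
    rw [← Category.assoc Φ, hΦN, Category.assoc]
    have h := congrArg transpose hΦN
    rw [transpose_comp_tr, transpose_comp, hφ] at h
    rw [Preadditive.comp_zsmul, h, Preadditive.zsmul_comp, smul_smul]
    rcases Int.units_eq_one_or ε with rfl | rfl <;> simp

end Symmetry

/-! ### Fixed points of a compatible involution of a torsor -/

section Torsor

variable {X H G : Type*} [AddCommGroup H] [AddCommGroup G] (r : X → G) (p : H →+ G)
  (D : X → X) (τ : H →+ H)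

/-- A set `X` embedded in a group `G` as a coset of the image of an injection `p : H → G`, with
an involution compatible with the endomorphism `τ` of `H`, has a fixed point if `H` is uniquely
`2`-divisible. -/
lemma exists_fixedPoint_of_involution (hr : Function.Injective r) (hp : Function.Injective p)
    (hsub : ∀ x y, ∃ u, r y = r x + p u) (hadd : ∀ x u, ∃ y, r y = r x + p u)
    (hD : ∀ x y u, r y = r x + p u → r (D y) = r (D x) + p (τ u)) (hDD : ∀ x, D (D x) = x)
    (hdiv : ∀ u : H, ∃ u', u' + u' = u) (htf : ∀ u : H, u + u = 0 → u = 0) (x : X) :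
    ∃ y, D y = y := by
  obtain ⟨u, hu⟩ := hsub x (D x)
  have h1 := hD _ _ _ hu
  rw [hDD, hu, add_assoc, left_eq_add, ← map_add] at h1
  replace h1 : u + τ u = 0 := hp (h1.trans p.map_zero.symm)
  -- With `u = 2t`, the fixed point is `x + t`: its image is `x + 2t + τ t`, and `τ t = -t`.
  obtain ⟨t, rfl⟩ := hdiv u
  have h2 : t + τ t = 0 := htf _ (by rw [← h1, map_add]; abel)
  obtain ⟨y, hy⟩ := hadd x t
  refine ⟨y, hr ?_⟩
  rw [hD _ _ _ hy, hy, hu, add_assoc, ← map_add, add_assoc, h2, add_zero]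

lemma fixedPoint_iff_of_involution (hr : Function.Injective r) (hp : Function.Injective p)
    (hD : ∀ x y u, r y = r x + p u → r (D y) = r (D x) + p (τ u)) {x y : X} {u : H}
    (hx : D x = x) (hu : r y = r x + p u) : D y = y ↔ τ u = u := by
  rw [← hr.eq_iff, hD _ _ _ hu, hx, hu, add_right_inj, hp.eq_iff]

/-- The fixed points of a compatible involution form a torsor under the fixed points of `τ`. -/
lemma exists_addTorsor_fixedPoints (hr : Function.Injective r) (hp : Function.Injective p)
    (hsub : ∀ x y, ∃ u, r y = r x + p u) (hadd : ∀ x u, ∃ y, r y = r x + p u)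
    (hD : ∀ x y u, r y = r x + p u → r (D y) = r (D x) + p (τ u))
    (S : AddSubgroup H) (hS : ∀ u, u ∈ S ↔ τ u = u) (E : Set X) (hE : ∀ x, x ∈ E ↔ D x = x)
    (hne : E.Nonempty) :
    ∃ _ : AddTorsor S E, ∀ (s : S) (x : E), r (s +ᵥ x : E).1 = r x.1 + p s.1 := by
  have hadd' (s : S) (x : E) : ∃ y : E, r y.1 = r x.1 + p s.1 := by
    obtain ⟨y, hy⟩ := hadd x.1 s.1
    exact ⟨⟨y, (hE y).2 ((fixedPoint_iff_of_involution r p D τ hr hp hD ((hE _).1 x.2) hy).2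
      ((hS _).1 s.2))⟩, hy⟩
  have hsub' (y x : E) : ∃ s : S, r y.1 = r x.1 + p s.1 := by
    obtain ⟨u, hu⟩ := hsub x.1 y.1
    exact ⟨⟨u, (hS u).2 ((fixedPoint_iff_of_involution r p D τ hr hp hD ((hE _).1 x.2) hu).1
      ((hE _).1 y.2))⟩, hu⟩
  choose a ha using hadd'
  choose b hb using hsub'
  have hr' {x y : E} (h : r x.1 = r y.1) : x = y := Subtype.ext (hr h)
  refine ⟨{
    vadd := a
    vsub := b
    nonempty := hne.to_subtype
    zero_vadd := fun x => hr' ((ha 0 x).trans (by simp))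
    add_vadd := fun s t x => hr' (by
      change r (a (s + t) x).1 = r (a s (a t x)).1
      rw [ha, ha, ha, AddSubgroup.coe_add, map_add]
      abel)
    vsub_vadd' := fun x y => hr' (by
      change r (a (b x y) y).1 = r x.1
      rw [ha, ← hb])
    vadd_vsub' := fun s x => by
      change b (a s x) x = s
      refine Subtype.ext (hp ?_)
      have h := hb (a s x) x
      rw [ha, add_right_inj] at h
      exact h.symm }, ha⟩

end Torsor

/-! ### Unique `2`-divisibility from the `k`-linear structure -/

section Divisibility

variable {k : Type w'} [Field k] [CharZero k] {C : Type u} [Category.{v} C] [Abelian C]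
  [Linear k C] [HasExt.{w} C] {Q P : C}

/-- Pushing out along `1/2` on `P` inverts doubling, which gives both divisibility by `2` and
absence of `2`-torsion. -/
lemma push_inv_two_add (k : Type w') [Field k] [CharZero k] [Linear k C] (x : Ext.{w} Q P 1) :
    push ((2⁻¹ : k) • 𝟙 P) (x + x) = x := by
  rw [map_add, ← push_add, ← add_smul, ← two_mul, mul_inv_cancel₀ two_ne_zero, one_smul, push_id]

end Divisibility

end SelfDualBlended

/-! ### The torsor of self-dual blended extensions -/

open SelfDualBlended
theorem mainTheorem1 {k : Type w'} [Field k] [CharZero k]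
    {T : Type u} [Category.{v} T] [Abelian T] [Linear k T] [MonoidalCategory T]
    [MonoidalPreadditive T] [MonoidalLinear k T] [SymmetricCategory T] [RightRigidCategory T]
    [NeutralTannakian k T] [HasExt.{w} T]
    {A B N : T} (M₁ : Extn N A) (M₂ : Extn B N)
    (hNA : ∀ f : N ⟶ A, f = 0)
    (ε : ℤˣ) (φ : N ≅ dual N) (lam : A ≅ dual B)
    (hφ : transpose φ.hom = (ε : ℤ) • φ.hom)
    (Φ : M₁.obj ⟶ M₂.dual.obj)
    (hΦA : M₁.i ≫ Φ = lam.hom ≫ M₂.dual.i)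
    (hΦN : Φ ≫ M₂.dual.p = M₁.p ≫ φ.hom)
    (hpan : Nonempty (Blended M₂ M₁)) :
    (extpanaut ε lam.hom Φ).Nonempty ∧
    (∃ S : AddSubgroup (Ext.{w} B (dual B) 1), (S : Set (Ext.{w} B (dual B) 1)) = extSign ε B ∧
      ∃ _ : AddTorsor S (extpanaut ε lam.hom Φ),
        ∀ (M : Blended M₂ M₁) (hM : M.cls ∈ extpanaut ε lam.hom Φ) (U : Extn B A)
          (hU : U.cls.comp (Ext.mk₀ lam.hom) (add_zero 1) ∈ S),
          ((⟨_, hU⟩ : S) +ᵥ (⟨M.cls, hM⟩ : extpanaut ε lam.hom Φ) : extpanaut ε lam.hom Φ).1 =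
            (M.translate U).cls) ∧
    (extSign.{w} ε B = Set.univ → extpanaut ε lam.hom Φ = Set.univ) ∧
    (extSign.{w} (-ε) B = Set.univ → ∃! x, x ∈ extpanaut ε lam.hom Φ) := by
  obtain ⟨D, rfl, rfl⟩ := exists_symmetricDuality ε φ lam hφ Φ hΦA hΦN
  have hNB (f : N ⟶ dual B) : f = 0 := by
    rw [← cancel_mono D.lam.inv, zero_comp]
    exact hNA _
  have hr := D.rowClass_injective.{w} hNA
  have hp := pull_p_injective.{w} M₂ hNB
  have hsub := D.exists_rowClass_eq_add.{w}
  have hadd (x : Extpan M₂ M₁) (u : Ext.{w} B (dual B) 1) :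
      ∃ y, D.rowClass y = D.rowClass x + pull M₂.p u := by
    obtain ⟨M, rfl⟩ := Quotient.exists_rep x
    obtain ⟨U, rfl⟩ := D.exists_translate u
    exact ⟨_, D.rowClass_translate M U⟩
  let τ : Ext.{w} B (dual B) 1 →+ Ext.{w} B (dual B) 1 :=
    AddMonoidHom.mk' (fun u => (ε : ℤ) • dualSelfHom B u) (fun u u' => by rw [map_add, smul_add])
  have hD : ∀ (x y : Extpan M₂ M₁) (u : Ext.{w} B (dual B) 1),
      D.rowClass y = D.rowClass x + pull M₂.p u →
        D.rowClass (D.dualExtpan y) = D.rowClass (D.dualExtpan x) + pull M₂.p (τ u) :=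
    D.rowClass_dualExtpan hNA
  have hdiv (u : Ext.{w} B (dual B) 1) : ∃ u', u' + u' = u :=
    ⟨push ((2⁻¹ : k) • 𝟙 _) u, by rw [← map_add, push_inv_two_add]⟩
  have htf (u : Ext.{w} B (dual B) 1) (hu : u + u = 0) : u = 0 := by
    rw [← push_inv_two_add k u, hu, map_zero]
  have hE := D.mem_extpanaut_iff hNA
  have hτ (u : Ext.{w} B (dual B) 1) : u ∈ extSign ε B ↔ τ u = u := by
    rw [mem_extSign_iff]
    change _ ↔ (ε : ℤ) • dualSelfHom B u = u
    constructor
    · intro h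
      rw [h, smul_smul]
      rcases Int.units_eq_one_or ε with rfl | rfl <;> simp
    · intro h
      conv_rhs => rw [← h, smul_smul]
      rcases Int.units_eq_one_or ε with rfl | rfl <;> simp
  obtain ⟨x₀, hx₀⟩ := exists_fixedPoint_of_involution D.rowClass (pull.{w} M₂.p) D.dualExtpan τ
    hr hp hsub hadd hD D.dualExtpan_dualExtpan hdiv htf hpan.some.cls
  have hfix (y : Extpan M₂ M₁) (u : Ext.{w} B (dual B) 1)
      (hu : D.rowClass y = D.rowClass x₀ + pull M₂.p u) :
      y ∈ extpanaut ε D.lam.hom D.Φ.hom ↔ u ∈ extSign ε B := by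
    rw [hE, hτ]
    exact fixedPoint_iff_of_involution D.rowClass (pull.{w} M₂.p) D.dualExtpan τ hr hp hD hx₀ hu
  have hne : (extpanaut ε D.lam.hom D.Φ.hom).Nonempty := ⟨x₀, (hE x₀).2 hx₀⟩
  refine ⟨hne, ?_, ?_, ?_⟩
  -- As `ε² = 1`, the condition `u^∨ = εu` reads `τ u = u`, so `Ext_ε` is a kernel.
  · let S : AddSubgroup (Ext.{w} B (dual B) 1) := (τ - AddMonoidHom.id _).ker
    have hS (u : Ext.{w} B (dual B) 1) : u ∈ S ↔ τ u = u := by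
      rw [AddMonoidHom.mem_ker, AddMonoidHom.sub_apply, sub_eq_zero, AddMonoidHom.id_apply]
    obtain ⟨T, hT⟩ := exists_addTorsor_fixedPoints D.rowClass (pull.{w} M₂.p) D.dualExtpan τ
      hr hp hsub hadd hD S hS _ hE hne
    refine ⟨S, Set.ext fun u => (hS u).trans (hτ u).symm, T, fun M hM U hU => hr ?_⟩
    rw [hT, D.rowClass_translate]
    rfl
  · intro h
    refine Set.eq_univ_of_forall fun y => ?_
    obtain ⟨u, hu⟩ := hsub x₀ y
    rw [hfix y u hu, h]
    trivial
  · intro h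
    refine ⟨x₀, (hE x₀).2 hx₀, fun y hy => ?_⟩
    obtain ⟨u, hu⟩ := hsub x₀ y
    have h1 := mem_extSign_iff.1 ((hfix y u hu).1 hy)
    have h2 : u ∈ extSign (-ε) B := h ▸ Set.mem_univ u
    -- Here `u^∨` is both `εu` and `-εu`, whence `2u = 0`.
    rw [mem_extSign_iff, h1, Units.val_neg, neg_smul, eq_neg_iff_add_eq_zero, ← smul_add] at h2
    have h3 : u + u = 0 := by
      rwa [← Units.smul_def, smul_eq_zero_iff_eq] at h2
    apply hr
    rw [hu, htf u h3, map_zero, add_zero]
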